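/- Let $n\ge 1$ be an integer and let $m\in[0,\infty)$ satisfy $m+n>2$. Consider the smooth metric measure space $(\mathbb{R}^n,dx^2,1^m\,\mathrm{dvol})$, that is, $(\mathbb{R}^n,dx^2,e^{-\phi}\,\mathrm{dvol},m)$ with $\phi=0$. On it the weighted scalar curvature $R_\phi^m=R+2\Delta\phi-\frac{m+1}{m}|\nabla\phi|^2$ vanishes, and the weighted Yamabe quotient is $$\mathcal{Q}(w)=\frac{\left(\int_{\mathbb{R}^n}|\nabla w|^2\,dx\right)\left(\int_{\mathbb{R}^n}|w|^{\frac{2(m+n-1)}{m+n-2}}\,dx\right)^{\frac{2m}{n}}}{\left(\int_{\mathbb{R}^n}|w|^{\frac{2(m+n)}{m+n-2}}\,dx\right)^{\frac{2m+n-2}{n}}}.$$ Let $w\in C^\infty(\mathbb{R}^n)$ be a positive critical point of $\mathcal{Q}$, i.e. $\frac{d}{dt}\big|_{t=0}\mathcal{Q}(w+t\xi)=0$ for every $\xi\in C_c^\infty(\mathbb{R}^n)$, and suppose additionally that the function $$\tilde w(x):=|x|^{2-m-n}\,w\!\left(\frac{x}{|x|^2}\right),\qquad x\ne 0,$$ admits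 an extension to a positive element of $C^2(\mathbb{R}^n)$. Then there exist constants $a,b>0$ and a point $x_0\in\mathbb{R}^n$ such that $$w(x)=\left(a+b|x-x_0|^2\right)^{-\frac{m+n-2}{2}}\qquad\text{for all }x\in\mathbb{R}^n.$$ -/

import Mathlib

open MeasureTheory
open scoped ContDiff

namespace WeightedYamabe

noncomputable section

/-- The smooth measure `e^{-φ} dvol` on `ℝⁿ`, where `dvol` is the volume element of the flat metric
`dx²`, i.e. Lebesgue measure. -/
def weightedVolume {n : ℕ} (φ : EuclideanSpace ℝ (Fin n) → ℝ) :
    Measure (EuclideanSpace ℝ (Fin n)) :=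
  volume.withDensity fun x => ENNReal.ofReal (Real.exp (-φ x))

/-- The weighted scalar curvature `R + 2 Δφ - ((m + 1) / m) |∇φ|²` of the smooth metric measure
space `(ℝⁿ, dx², e^{-φ} dvol, m)`, with `m` finite.  The scalar curvature `R` of the flat metric
`dx²` is zero.  For `m = 0` one requires `φ = 0`, so that the last term is zero. -/
def weightedScalarCurvature {n : ℕ} (φ : EuclideanSpace ℝ (Fin n) → ℝ) (m : ℝ)
    (x : EuclideanSpace ℝ (Fin n)) : ℝ :=
  2 * Laplacian.laplacian φ x - (m + 1) / m * ‖gradient φ x‖ ^ 2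

/-- The weighted Yamabe quotient of the smooth metric measure space `(ℝⁿ, dx², e^{-φ} dvol, m)`,
with `m` finite:
`(∫ |∇w|² + (m+n-2)/(4(m+n-1)) R_φ^m w²) (∫ |w|^(2(m+n-1)/(m+n-2)) e^(φ/m))^(2m/n)`
divided by `(∫ |w|^(2(m+n)/(m+n-2)))^((2m+n-2)/n)`,
all integrals being taken with respect to `e^{-φ} dvol`. -/
def yamabeQuotient {n : ℕ} (φ : EuclideanSpace ℝ (Fin n) → ℝ) (m : ℝ)
    (w : EuclideanSpace ℝ (Fin n) → ℝ) : ℝ :=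
  (∫ x, (‖gradient w x‖ ^ 2
      + (m + n - 2) / (4 * (m + n - 1)) * weightedScalarCurvature φ m x * w x ^ 2)
      ∂(weightedVolume φ))
    * (∫ x, |w x| ^ (2 * (m + n - 1) / (m + n - 2)) * Real.exp (φ x / m)
      ∂(weightedVolume φ)) ^ (2 * m / n)
    / (∫ x, |w x| ^ (2 * (m + n) / (m + n - 2)) ∂(weightedVolume φ)) ^ ((2 * m + n - 2) / n)

/-- `w` is a critical point of the functional `Q`: the first variation of `Q` at `w` vanishes in
the direction of every smooth compactly supported function. -/
def IsCriticalPoint {n : ℕ} (Q : (EuclideanSpace ℝ (Fin n) → ℝ) → ℝ)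
    (w : EuclideanSpace ℝ (Fin n) → ℝ) : Prop :=
  ∀ ξ : EuclideanSpace ℝ (Fin n) → ℝ, ContDiff ℝ ∞ ξ → HasCompactSupport ξ →
    HasDerivAt (fun t : ℝ => Q (fun x => w x + t * ξ x)) 0 0

/-- The Kelvin-type transform `w̃(x) = |x|^(2-m-n) w(x / |x|²)`; it is meaningful for `x ≠ 0`. -/
def kelvinTransform {n : ℕ} (m : ℝ) (w : EuclideanSpace ℝ (Fin n) → ℝ)
    (x : EuclideanSpace ℝ (Fin n)) : ℝ :=
  ‖x‖ ^ (2 - m - n) * w ((‖x‖ ^ 2)⁻¹ • x)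

end

end WeightedYamabe

namespace WeightedYamabe

/-! Put `N = m + n`, `s = (N - 2) / 2` and `w = v ^ (-s)`. The claim becomes that `v` is a positive
definite quadratic polynomial, and the Euler–Lagrange equation of the quotient becomes `v Δv = (N/2)
|∇v|² + c₂ - 2 m b v`, with constants given by the integrals in the quotient (`eulerLagrange`,
`equation_of_rpow`).

The rest is Obata's argument with `m` as extra dimensions. Differentiating the equation twice gives
`div (v^(2-N) ∇Δv) = v^(1-N) (D + 2 m b (Δv - 2 n b))`, where `D = m |Hess v - 2b I|² + n |Hess v -
(Δv/n) I|² ≥ 0` (`rpow_mul_obataDefect`, `obataDefect_eq`). The left side integrates to zero, and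
the values of `c₂` and `b` are exactly those for which `v^(1-N) (Δv - 2 n b)` integrates to zero.
Hence `D = 0`, which leads to `Hess v = 2b I` (`pd_pd_eq_of_equation`), and integration gives the
quadratic.

The Kelvin hypothesis controls infinity: `v` equals `|x|²` times a positive `C¹` function of `x /
|x|²`, so `v` is comparable to `1 + |x|²` and `|∇v|² = O(1 + |x|²)`
(`quadratic_growth_of_inversion`). This makes the integrals finite and removes the boundary terms.
-/

/-- The `i`-th partial derivative of a function on Euclidean space. -/
noncomputable def pd {n : ℕ} (i : Fin n) (f : EuclideanSpace ℝ (Fin n) → ℝ)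
    (x : EuclideanSpace ℝ (Fin n)) : ℝ :=
  fderiv ℝ f x (EuclideanSpace.single i 1)

/-! ### Calculus of partial derivatives and integration by parts. -/

section PartialDerivatives

variable {n : ℕ} {f g : EuclideanSpace ℝ (Fin n) → ℝ}

lemma contDiff_pd (hf : ContDiff ℝ ∞ f) (i : Fin n) : ContDiff ℝ ∞ (pd i f) :=
  (hf.fderiv_right (m := ∞) (by simp)).clm_apply contDiff_const

lemma pd_add (hf : Differentiable ℝ f) (hg : Differentiable ℝ g) (i : Fin n)
    (x : EuclideanSpace ℝ (Fin n)) :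
    pd i (fun y => f y + g y) x = pd i f x + pd i g x := by
  simp only [pd]
  rw [fderiv_fun_add (hf x) (hg x)]; rfl

lemma pd_sub (hf : Differentiable ℝ f) (hg : Differentiable ℝ g) (i : Fin n)
    (x : EuclideanSpace ℝ (Fin n)) :
    pd i (fun y => f y - g y) x = pd i f x - pd i g x := by
  simp only [pd]
  rw [fderiv_fun_sub (hf x) (hg x)]; rfl

lemma pd_mul (hf : Differentiable ℝ f) (hg : Differentiable ℝ g) (i : Fin n)
    (x : EuclideanSpace ℝ (Fin n)) :
    pd i (fun y => f y * g y) x = f x * pd i g x + pd i f x * g x := by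
  simp only [pd]
  rw [fderiv_fun_mul (hf x) (hg x)]
  simp [mul_comm]

lemma pd_const (c : ℝ) (i : Fin n) (x : EuclideanSpace ℝ (Fin n)) :
    pd i (fun _ => c) x = 0 := by
  simp [pd]

lemma pd_const_mul (hf : Differentiable ℝ f) (c : ℝ) (i : Fin n)
    (x : EuclideanSpace ℝ (Fin n)) :
    pd i (fun y => c * f y) x = c * pd i f x := by
  rw [pd_mul (by fun_prop) hf, pd_const]; ring

lemma pd_sum {ι : Type*} {s : Finset ι} {F : ι → EuclideanSpace ℝ (Fin n) → ℝ}
    (hF : ∀ k, Differentiable ℝ (F k)) (i : Fin n) (x : EuclideanSpace ℝ (Fin n)) :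
    pd i (fun y => ∑ k ∈ s, F k y) x = ∑ k ∈ s, pd i (F k) x := by
  simp only [pd]
  rw [fderiv_fun_sum fun k _ => hF k x]
  simp

lemma pd_comp {φ : ℝ → ℝ} {φ' : ℝ} {x : EuclideanSpace ℝ (Fin n)} (hφ : HasDerivAt φ φ' (f x))
    (hf : DifferentiableAt ℝ f x) (i : Fin n) :
    pd i (fun y => φ (f y)) x = φ' * pd i f x := by
  have h := hφ.comp_hasFDerivAt x hf.hasFDerivAt
  simp only [pd]
  rw [show (fun y => φ (f y)) = φ ∘ f from rfl, h.fderiv]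
  simp

lemma pd_rpow (hf : Differentiable ℝ f) (hpos : ∀ x, 0 < f x) (r : ℝ) (i : Fin n)
    (x : EuclideanSpace ℝ (Fin n)) :
    pd i (fun y => f y ^ r) x = r * f x ^ (r - 1) * pd i f x :=
  pd_comp (Real.hasDerivAt_rpow_const (Or.inl (hpos x).ne')) (hf x) i

lemma contDiff_rpow (hf : ContDiff ℝ ∞ f) (hpos : ∀ x, 0 < f x) (r : ℝ) :
    ContDiff ℝ ∞ (fun y => f y ^ r) :=
  hf.rpow_const_of_ne fun x => (hpos x).ne'

lemma pd_comm (hf : ContDiff ℝ ∞ f) (i j : Fin n) (x : EuclideanSpace ℝ (Fin n)) :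
    pd i (pd j f) x = pd j (pd i f) x := by
  have hd : DifferentiableAt ℝ (fderiv ℝ f) x :=
    (hf.fderiv_right (m := ∞) (by simp)).differentiable (by simp) x
  have key : ∀ a b : Fin n, pd a (pd b f) x =
      fderiv ℝ (fderiv ℝ f) x (EuclideanSpace.single a 1) (EuclideanSpace.single b 1) := by
    intro a b
    have h := hd.hasFDerivAt.clm_apply
      (hasFDerivAt_const (EuclideanSpace.single b (1 : ℝ)) x)
    change fderiv ℝ (fun y => fderiv ℝ f y (EuclideanSpace.single b 1)) x _ = _
    rw [h.fderiv]
    simp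
  rw [key, key]
  exact ((contDiff_infty.mp hf 2).contDiffAt.isSymmSndFDerivAt (by simp)) _ _

lemma hasCompactSupport_pd (hf : HasCompactSupport f) (i : Fin n) :
    HasCompactSupport (pd i f) :=
  HasCompactSupport.of_support_subset_isCompact (hf.fderiv ℝ) fun x hx => by
    apply subset_tsupport
    intro h
    apply hx
    simp [pd, h]

lemma integral_mul_pd (hf : ContDiff ℝ ∞ f) (hg : ContDiff ℝ ∞ g) (hs : HasCompactSupport g)
    (i : Fin n) : ∫ x, f x * pd i g x = - ∫ x, pd i f x * g x := by
  have hcf := (contDiff_pd hf i).continuous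
  have hcg := (contDiff_pd hg i).continuous
  apply integral_mul_fderiv_eq_neg_fderiv_mul_of_integrable
  · exact (hcf.mul hg.continuous).integrable_of_hasCompactSupport hs.mul_left
  · exact (hf.continuous.mul hcg).integrable_of_hasCompactSupport
      (hasCompactSupport_pd hs i).mul_left
  · exact (hf.continuous.mul hg.continuous).integrable_of_hasCompactSupport hs.mul_left
  · exact fun x _ => hf.differentiable (by simp) x
  · exact fun x _ => hg.differentiable (by simp) x

lemma fderiv_eq_zero_of_pd {x : EuclideanSpace ℝ (Fin n)} (h : ∀ i, pd i f x = 0) :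
    fderiv ℝ f x = 0 := by
  apply ContinuousLinearMap.coe_injective
  apply (EuclideanSpace.basisFun (Fin n) ℝ).toBasis.ext
  intro i
  simpa [pd] using h i

lemma eq_of_pd_eq_zero (hf : Differentiable ℝ f) (h : ∀ i x, pd i f x = 0)
    (x y : EuclideanSpace ℝ (Fin n)) : f x = f y :=
  is_const_of_fderiv_eq_zero hf (fun z => fderiv_eq_zero_of_pd fun i => h i z) x y

lemma norm_sq_gradient (f : EuclideanSpace ℝ (Fin n) → ℝ) (x : EuclideanSpace ℝ (Fin n)) :
    ‖gradient f x‖ ^ 2 = ∑ i, pd i f x ^ 2 := by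
  rw [EuclideanSpace.norm_sq_eq]
  refine Finset.sum_congr rfl fun i _ => ?_
  have : pd i f x = inner ℝ (gradient f x) (EuclideanSpace.single i (1 : ℝ)) := by
    simp [pd, gradient, InnerProductSpace.toDual_symm_apply]
  rw [this, EuclideanSpace.inner_single_right]
  simp

lemma abs_pd_le (i : Fin n) (x : EuclideanSpace ℝ (Fin n)) : |pd i f x| ≤ ‖fderiv ℝ f x‖ := by
  have h := (fderiv ℝ f x).le_opNorm (EuclideanSpace.single i 1)
  simpa [pd] using h

end PartialDerivatives

/-! ### Cutoff functions and limits of truncated integrals. -/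

section Cutoff

open Filter Topology

variable {n : ℕ}

lemma pd_comp_smul (f : EuclideanSpace ℝ (Fin n) → ℝ) (c : ℝ) (i : Fin n)
    (x : EuclideanSpace ℝ (Fin n)) :
    pd i (fun y => f (c • y)) x = c * pd i f (c • x) := by
  simp only [pd]
  rw [fderiv_comp_smul]
  simp

lemma pd_eq_zero_of_eq_const {f : EuclideanSpace ℝ (Fin n) → ℝ}
    {U : Set (EuclideanSpace ℝ (Fin n))} (hU : IsOpen U) {c : ℝ} (h : ∀ y ∈ U, f y = c)
    (i : Fin n) : ∀ y ∈ U, pd i f y = 0 := by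
  intro y hy
  have : f =ᶠ[𝓝 y] fun _ => c := by
    filter_upwards [hU.mem_nhds hy] with z hz using h z hz
  simp [pd, this.fderiv_eq]

/-- Smooth compactly supported cutoff functions exhausting Euclidean space, whose derivatives decay
at the scale-invariant rate. -/
structure IsCutoffSequence (η : ℕ → EuclideanSpace ℝ (Fin n) → ℝ) (M : ℝ) : Prop where
  contDiff : ∀ k, ContDiff ℝ ∞ (η k)
  compact : ∀ k, HasCompactSupport (η k)
  nonneg : ∀ k x, 0 ≤ η k x
  le_one : ∀ k x, η k x ≤ 1
  pd_sq_le : ∀ k i x, pd i (η k) x ^ 2 * (1 + ‖x‖ ^ 2) ≤ M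
  pd_pd_le : ∀ k i x, |pd i (pd i (η k)) x| * (1 + ‖x‖ ^ 2) ≤ M
  eventually_one : ∀ x, ∀ᶠ k in atTop, η k x = 1
  eventually_pd : ∀ x, ∀ᶠ k in atTop, ∀ i, pd i (η k) x = 0
  eventually_pd_pd : ∀ x, ∀ᶠ k in atTop, ∀ i, pd i (pd i (η k)) x = 0

/-- Rescale a single bump to `φ (x / (k + 1))`. Each derivative costs a factor `1 / (k + 1)` and
lives where `|x| ≤ 2 (k + 1)`, which is what makes the decay bounds uniform in `k`. -/
lemma exists_isCutoffSequence (n : ℕ) :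
    ∃ (η : ℕ → EuclideanSpace ℝ (Fin n) → ℝ) (M : ℝ), IsCutoffSequence η M := by
  let φ : ContDiffBump (0 : EuclideanSpace ℝ (Fin n)) := ⟨1, 2, one_pos, one_lt_two⟩
  have hφ : ContDiff ℝ ∞ φ := φ.contDiff
  have hφc : HasCompactSupport φ := φ.hasCompactSupport
  have hpd1 : ∀ i, ∃ C, ∀ x, ‖pd i φ x‖ ≤ C := fun i =>
    (hasCompactSupport_pd hφc i).exists_bound_of_continuous (contDiff_pd hφ i).continuous
  have hpd2 : ∀ i, ∃ C, ∀ x, ‖pd i (pd i φ) x‖ ≤ C := fun i =>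
    (hasCompactSupport_pd (hasCompactSupport_pd hφc i) i).exists_bound_of_continuous
      (contDiff_pd (contDiff_pd hφ i) i).continuous
  choose C1 hC1 using hpd1
  choose C2 hC2 using hpd2
  have hone : ∀ y ∈ Metric.ball (0 : EuclideanSpace ℝ (Fin n)) 1, φ y = 1 := fun y hy =>
    φ.one_of_mem_closedBall (Metric.ball_subset_closedBall hy)
  have hz1 := fun i => pd_eq_zero_of_eq_const Metric.isOpen_ball hone i
  have hz2 := fun i => pd_eq_zero_of_eq_const Metric.isOpen_ball (hz1 i) i
  have hout : ∀ y ∈ (Metric.closedBall (0 : EuclideanSpace ℝ (Fin n)) 2)ᶜ, φ y = 0 := by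
    intro y hy
    apply φ.zero_of_le_dist
    simp only [Set.mem_compl_iff, Metric.mem_closedBall, not_le] at hy
    exact hy.le
  have ho1 := fun i => pd_eq_zero_of_eq_const Metric.isClosed_closedBall.isOpen_compl hout i
  have ho2 := fun i => pd_eq_zero_of_eq_const Metric.isClosed_closedBall.isOpen_compl (ho1 i) i
  let c : ℕ → ℝ := fun k => ((k : ℝ) + 1)⁻¹
  have hc0 : ∀ k, 0 ≤ c k := fun k => by positivity
  have hc1 : ∀ k, c k ≤ 1 := fun k => inv_le_one_of_one_le₀ (by
    have : (0 : ℝ) ≤ k := k.cast_nonneg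
    linarith)
  -- The 5 is `1 + 4`, from `c k ≤ 1` and `(c k ‖x‖)² ≤ 4`.
  have hscale : ∀ k (x : EuclideanSpace ℝ (Fin n)), c k • x ∈ Metric.closedBall 0 2 →
      c k ^ 2 * (1 + ‖x‖ ^ 2) ≤ 5 := by
    intro k x hx
    rw [mem_closedBall_zero_iff, norm_smul, Real.norm_of_nonneg (hc0 k)] at hx
    have h1 : c k ^ 2 ≤ 1 := pow_le_one₀ (hc0 k) (hc1 k)
    have h2 : (c k * ‖x‖) ^ 2 ≤ 2 ^ 2 := by
      have := mul_nonneg (hc0 k) (norm_nonneg x)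
      gcongr
    nlinarith
  have hlim : ∀ x : EuclideanSpace ℝ (Fin n),
      ∀ᶠ k in atTop, c k • x ∈ Metric.ball (0 : EuclideanSpace ℝ (Fin n)) 1 := by
    intro x
    have h1 : Tendsto c atTop (𝓝 0) := by
      simpa [c, one_div] using tendsto_one_div_add_atTop_nhds_zero_nat (𝕜 := ℝ)
    have h2 : Tendsto (fun k => c k • x) atTop (𝓝 0) := by
      simpa using h1.smul_const x
    exact h2.eventually (Metric.ball_mem_nhds _ one_pos)
  have e1 : ∀ k i x, pd i (fun y => φ (c k • y)) x = c k * pd i φ (c k • x) :=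
    fun k i x => pd_comp_smul φ (c k) i x
  have e2 : ∀ k i x, pd i (pd i (fun y => φ (c k • y))) x
      = c k ^ 2 * pd i (pd i φ) (c k • x) := by
    intro k i x
    have hd : Differentiable ℝ (pd i φ) := (contDiff_pd hφ i).differentiable (by simp)
    rw [show pd i (fun y => φ (c k • y)) = fun y => c k * pd i φ (c k • y) from
      funext fun y => e1 k i y]
    rw [pd_const_mul (f := fun y => pd i φ (c k • y))
      (hd.comp (differentiable_id.const_smul (c k))), pd_comp_smul]
    ring
  have hle1 : ∀ i, C1 i ^ 2 ≤ ∑ j, (C1 j ^ 2 + C2 j) := by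
    intro i
    have hC2n : ∀ j, 0 ≤ C2 j := fun j => (norm_nonneg _).trans (hC2 j 0)
    have := Finset.single_le_sum (f := fun j => C1 j ^ 2 + C2 j)
      (fun j _ => add_nonneg (sq_nonneg _) (hC2n j)) (Finset.mem_univ i)
    have := hC2n i
    linarith
  have hle2 : ∀ i, C2 i ≤ ∑ j, (C1 j ^ 2 + C2 j) := by
    intro i
    have hC2n : ∀ j, 0 ≤ C2 j := fun j => (norm_nonneg _).trans (hC2 j 0)
    have := Finset.single_le_sum (f := fun j => C1 j ^ 2 + C2 j)
      (fun j _ => add_nonneg (sq_nonneg _) (hC2n j)) (Finset.mem_univ i)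
    have := sq_nonneg (C1 i)
    linarith
  set S := ∑ j, (C1 j ^ 2 + C2 j) with hS
  have hS0 : 0 ≤ S := Finset.sum_nonneg fun j _ =>
    add_nonneg (sq_nonneg _) ((norm_nonneg _).trans (hC2 j 0))
  refine ⟨fun k x => φ (c k • x), 5 * S, ?_, ?_, ?_, ?_, ?_, ?_, ?_, ?_, ?_⟩
  · exact fun k => hφ.comp (contDiff_const_smul (c k))
  · exact fun k => hφc.comp_smul (by positivity)
  · exact fun k x => φ.nonneg
  · exact fun k x => φ.le_one
  · intro k i x
    rw [e1]
    by_cases hx : c k • x ∈ Metric.closedBall (0 : EuclideanSpace ℝ (Fin n)) 2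
    · have h1 : pd i φ (c k • x) ^ 2 ≤ S := by
        refine le_trans ?_ (hle1 i)
        rw [← sq_abs]
        have := hC1 i (c k • x)
        rw [Real.norm_eq_abs] at this
        gcongr
      calc (c k * pd i φ (c k • x)) ^ 2 * (1 + ‖x‖ ^ 2)
          = (c k ^ 2 * (1 + ‖x‖ ^ 2)) * pd i φ (c k • x) ^ 2 := by ring
        _ ≤ 5 * S := mul_le_mul (hscale k x hx) h1 (sq_nonneg _) (by norm_num)
    · rw [ho1 i _ hx]
      simpa using hS0
  · intro k i x
    rw [e2]
    by_cases hx : c k • x ∈ Metric.closedBall (0 : EuclideanSpace ℝ (Fin n)) 2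
    · have h1 : |pd i (pd i φ) (c k • x)| ≤ S := (hC2 i (c k • x)).trans (hle2 i)
      calc |c k ^ 2 * pd i (pd i φ) (c k • x)| * (1 + ‖x‖ ^ 2)
          = (c k ^ 2 * (1 + ‖x‖ ^ 2)) * |pd i (pd i φ) (c k • x)| := by
            rw [abs_mul, abs_of_nonneg (sq_nonneg (c k))]; ring
        _ ≤ 5 * S := mul_le_mul (hscale k x hx) h1 (abs_nonneg _) (by norm_num)
    · rw [ho2 i _ hx]
      simpa using hS0
  · intro x
    filter_upwards [hlim x] with k hk using hone _ hk
  · intro x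
    filter_upwards [hlim x] with k hk i
    rw [e1, hz1 i _ hk, mul_zero]
  · intro x
    filter_upwards [hlim x] with k hk i
    rw [e2, hz2 i _ hk, mul_zero]

lemma IsCutoffSequence.tendsto_integral_mul {η : ℕ → EuclideanSpace ℝ (Fin n) → ℝ} {M : ℝ}
    (hη : IsCutoffSequence η M) {F : EuclideanSpace ℝ (Fin n) → ℝ} (hF : Integrable F) :
    Tendsto (fun k => ∫ x, η k x * F x) atTop (𝓝 (∫ x, F x)) := by
  refine tendsto_integral_of_dominated_convergence (fun x => ‖F x‖) ?_ hF.norm ?_ ?_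
  · exact fun k => ((hη.contDiff k).continuous.aestronglyMeasurable).mul hF.1
  · refine fun k => ae_of_all _ fun x => ?_
    rw [norm_mul, Real.norm_of_nonneg (hη.nonneg k x)]
    exact mul_le_of_le_one_left (norm_nonneg _) (hη.le_one k x)
  · refine ae_of_all _ fun x => ?_
    refine tendsto_const_nhds.congr' ?_
    filter_upwards [hη.eventually_one x] with k hk
    rw [hk, one_mul]

/-- Fatou's lemma, so `F` need not be known to be integrable; this matters for the Obata defect,
whose integrability is not known beforehand. -/
lemma IsCutoffSequence.eq_zero_of_tendsto {η : ℕ → EuclideanSpace ℝ (Fin n) → ℝ} {M : ℝ}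
    (hη : IsCutoffSequence η M) {F : EuclideanSpace ℝ (Fin n) → ℝ} (hF : Continuous F)
    (hF0 : ∀ x, 0 ≤ F x) (h : Tendsto (fun k => ∫ x, η k x * F x) atTop (𝓝 0)) :
    ∀ x, F x = 0 := by
  have hnn : ∀ k x, 0 ≤ η k x * F x := fun k x => mul_nonneg (hη.nonneg k x) (hF0 x)
  have hcont : ∀ k, Continuous fun x => η k x * F x := fun k => (hη.contDiff k).continuous.mul hF
  have h1 : ∫⁻ x, liminf (fun k => ENNReal.ofReal (η k x * F x)) atTop ≤
      liminf (fun k => ∫⁻ x, ENNReal.ofReal (η k x * F x)) atTop :=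
    lintegral_liminf_le fun k => (hcont k).measurable.ennreal_ofReal
  have h2 : ∀ x, liminf (fun k => ENNReal.ofReal (η k x * F x)) atTop = ENNReal.ofReal (F x) := by
    intro x
    refine Tendsto.liminf_eq (tendsto_const_nhds.congr' ?_)
    filter_upwards [hη.eventually_one x] with k hk
    rw [hk, one_mul]
  have h3 : ∀ k, ∫⁻ x, ENNReal.ofReal (η k x * F x) = ENNReal.ofReal (∫ x, η k x * F x) := by
    intro k
    rw [ofReal_integral_eq_lintegral_ofReal
      ((hcont k).integrable_of_hasCompactSupport (hη.compact k).mul_right)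
      (ae_of_all _ (hnn k))]
  have h4 : liminf (fun k => ∫⁻ x, ENNReal.ofReal (η k x * F x)) atTop = 0 := by
    simp_rw [h3]
    have := (ENNReal.continuous_ofReal.tendsto 0).comp h
    rw [ENNReal.ofReal_zero] at this
    exact this.liminf_eq
  simp_rw [h2] at h1
  rw [h4, nonpos_iff_eq_zero, lintegral_eq_zero_iff hF.measurable.ennreal_ofReal] at h1
  have h5 : F =ᵐ[volume] fun _ => 0 := by
    filter_upwards [h1] with x hx
    exact le_antisymm (ENNReal.ofReal_eq_zero.mp hx) (hF0 x)
  exact fun x => congrFun ((hF.ae_eq_iff_eq volume continuous_const).mp h5) x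

end Cutoff

/-! ### Obata's rigidity argument for the equation satisfied by `v`. -/

section Obata

open Filter Topology

variable {n : ℕ}

lemma integral_rpow_pos {w : EuclideanSpace ℝ (Fin n) → ℝ} (hpos : ∀ x, 0 < w x) {r : ℝ}
    (hint : Integrable fun x => w x ^ r) : 0 < ∫ x, w x ^ r := by
  rw [integral_pos_iff_support_of_nonneg
    (fun x => (Real.rpow_pos_of_pos (hpos x) _).le) hint]
  have : Function.support (fun x => w x ^ r) = Set.univ := by
    ext y
    simp [(Real.rpow_pos_of_pos (hpos y) r).ne']
  rw [this]
  exact isOpen_univ.measure_pos _ Set.univ_nonempty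

/-- The sum of the pure second partial derivatives. -/
noncomputable def lap (f : EuclideanSpace ℝ (Fin n) → ℝ) (x : EuclideanSpace ℝ (Fin n)) : ℝ :=
  ∑ i, pd i (pd i f) x

lemma contDiff_lap {f : EuclideanSpace ℝ (Fin n) → ℝ} (hf : ContDiff ℝ ∞ f) :
    ContDiff ℝ ∞ (lap f) :=
  ContDiff.sum fun i _ => contDiff_pd (contDiff_pd hf i) i

lemma pd_lap {f : EuclideanSpace ℝ (Fin n) → ℝ} (hf : ContDiff ℝ ∞ f) (i : Fin n)
    (x : EuclideanSpace ℝ (Fin n)) :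
    pd i (lap f) x = ∑ j, pd j (pd j (pd i f)) x := by
  unfold lap
  rw [pd_sum fun k => (contDiff_pd (contDiff_pd hf k) k).differentiable (by simp)]
  refine Finset.sum_congr rfl fun j _ => ?_
  rw [pd_comm (contDiff_pd hf j), show pd i (pd j f) = pd j (pd i f) from funext (pd_comm hf i j)]

variable {v : EuclideanSpace ℝ (Fin n) → ℝ} {m N b c₂ : ℝ}

lemma mul_pd_lap (hv : ContDiff ℝ ∞ v)
    (heq : ∀ x, v x * lap v x = N / 2 * ∑ i, pd i v x * pd i v x + c₂ - 2 * m * b * v x)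
    (j : Fin n) (x : EuclideanSpace ℝ (Fin n)) :
    v x * pd j (lap v) x
      = N * ∑ i, pd i v x * pd j (pd i v) x - (lap v x + 2 * m * b) * pd j v x := by
  have dv : Differentiable ℝ v := hv.differentiable (by simp)
  have dl : Differentiable ℝ (lap v) := (contDiff_lap hv).differentiable (by simp)
  have dp : ∀ i, Differentiable ℝ (pd i v) := fun i =>
    (contDiff_pd hv i).differentiable (by simp)
  have h := congrArg (fun g => pd j g x) (funext heq)
  rw [pd_mul dv dl, pd_sub (by fun_prop) (by fun_prop), pd_add (by fun_prop) (by fun_prop),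
    pd_const, pd_const_mul (by fun_prop), pd_const_mul dv,
    pd_sum (F := fun i y => pd i v y * pd i v y) (fun i => (dp i).mul (dp i))] at h
  simp_rw [pd_mul (dp _) (dp _)] at h
  have e : ∑ i, (pd i v x * pd j (pd i v) x + pd j (pd i v) x * pd i v x)
      = 2 * ∑ i, pd i v x * pd j (pd i v) x := by
    rw [Finset.mul_sum]
    exact Finset.sum_congr rfl fun i _ => by ring
  rw [e] at h
  linarith

/-- Differentiate the equation once more and sum over `j`. As on flat space derivatives commute, the
third-order terms collapse to `⟨∇v, ∇Δv⟩`, as in Bochner's formula. -/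
lemma mul_lap_lap (hv : ContDiff ℝ ∞ v)
    (heq : ∀ x, v x * lap v x = N / 2 * ∑ i, pd i v x * pd i v x + c₂ - 2 * m * b * v x)
    (x : EuclideanSpace ℝ (Fin n)) :
    v x * lap (lap v) x
      = N * ∑ j, ∑ i, pd j (pd i v) x ^ 2 - lap v x ^ 2 - 2 * m * b * lap v x
        + (N - 2) * ∑ j, pd j v x * pd j (lap v) x := by
  have dv : Differentiable ℝ v := hv.differentiable (by simp)
  have hl := contDiff_lap hv
  have dl : Differentiable ℝ (lap v) := hl.differentiable (by simp)
  have dp : ∀ i, Differentiable ℝ (pd i v) := fun i =>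
    (contDiff_pd hv i).differentiable (by simp)
  have dh : ∀ i j, Differentiable ℝ (pd j (pd i v)) := fun i j =>
    (contDiff_pd (contDiff_pd hv i) j).differentiable (by simp)
  have dpl : ∀ i, Differentiable ℝ (pd i (lap v)) := fun i =>
    (contDiff_pd hl i).differentiable (by simp)
  have key : ∀ j, v x * pd j (pd j (lap v)) x + pd j v x * pd j (lap v) x
      = N * ∑ i, (pd i v x * pd j (pd j (pd i v)) x + pd j (pd i v) x ^ 2)
        - ((lap v x + 2 * m * b) * pd j (pd j v) x + pd j (lap v) x * pd j v x) := by
    intro j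
    have h := congrArg (fun g => pd j g x) (funext fun y => mul_pd_lap hv heq j y)
    have dph : ∀ i, Differentiable ℝ fun y => pd i v y * pd j (pd i v) y :=
      fun i => (dp i).mul (dh i j)
    have dlb : Differentiable ℝ fun y => lap v y + 2 * m * b := by fun_prop
    rw [pd_mul dv (dpl j), pd_sub (by fun_prop) (by fun_prop), pd_const_mul (by fun_prop),
      pd_sum (F := fun i y => pd i v y * pd j (pd i v) y) dph, pd_mul dlb (dp j),
      pd_add dl (by fun_prop), pd_const] at h
    simp_rw [pd_mul (dp _) (dh _ j)] at h
    rw [h]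
    simp only [sq, add_zero]
  have hsum := Finset.sum_congr (rfl : (Finset.univ : Finset (Fin n)) = _) fun j _ => key j
  rw [Finset.sum_add_distrib, ← Finset.mul_sum, Finset.sum_sub_distrib, ← Finset.mul_sum,
    Finset.sum_add_distrib, ← Finset.mul_sum] at hsum
  simp_rw [Finset.sum_add_distrib] at hsum
  have e1 : ∑ j, ∑ i, pd i v x * pd j (pd j (pd i v)) x = ∑ i, pd i v x * pd i (lap v) x := by
    rw [Finset.sum_comm]
    refine Finset.sum_congr rfl fun i _ => ?_
    rw [pd_lap hv, Finset.mul_sum]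
  have e2 : ∑ j, pd j (lap v) x * pd j v x = ∑ j, pd j v x * pd j (lap v) x :=
    Finset.sum_congr rfl fun _ _ => mul_comm _ _
  rw [e1, e2] at hsum
  change v x * lap (lap v) x + _ = N * (_ + _) - ((_ + _) * lap v x + _) at hsum
  linarith

/-- The quadratic expression `N |G|² - (tr G)²` in `G = Hess v - 2 b I`, which vanishes exactly for
the extremals. -/
noncomputable def obataDefect (v : EuclideanSpace ℝ (Fin n) → ℝ) (N b : ℝ)
    (x : EuclideanSpace ℝ (Fin n)) : ℝ :=
  N * ∑ j, ∑ i, (pd j (pd i v) x - if j = i then 2 * b else 0) ^ 2 - (lap v x - 2 * n * b) ^ 2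

lemma sum_sum_sub_diag_sq (A : Fin n → Fin n → ℝ) (s : ℝ) :
    ∑ j, ∑ i, (A j i - if j = i then s else 0) ^ 2
      = ∑ j, ∑ i, A j i ^ 2 - 2 * s * ∑ j, A j j + n * s ^ 2 := by
  have : ∀ j i, (A j i - if j = i then s else 0) ^ 2
      = A j i ^ 2 - (if j = i then 2 * s * A j i - s ^ 2 else 0) := by
    intro j i
    split_ifs <;> ring
  simp_rw [this, Finset.sum_sub_distrib, Finset.sum_ite_eq, Finset.mem_univ, if_true,
    Finset.sum_sub_distrib, Finset.mul_sum]
  simp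
  ring

/-- Completing the square in the Hessian around `2b I`; the leftover is linear in `Δv` precisely
because `N = m + n`. -/
lemma mul_lap_lap_eq_obataDefect (hN : N = m + n) (hv : ContDiff ℝ ∞ v)
    (heq : ∀ x, v x * lap v x = N / 2 * ∑ i, pd i v x * pd i v x + c₂ - 2 * m * b * v x)
    (x : EuclideanSpace ℝ (Fin n)) :
    v x * lap (lap v) x - (N - 2) * ∑ j, pd j v x * pd j (lap v) x
      = obataDefect v N b x + 2 * m * b * (lap v x - 2 * n * b) := by
  rw [mul_lap_lap hv heq, obataDefect, sum_sum_sub_diag_sq (fun j i => pd j (pd i v) x)]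
  change _ = N * (_ - _ * lap v x + _) - _ + _
  rw [hN]
  ring

/-- Splits the Hessian into trace and trace-free parts, which makes the defect visibly nonnegative
for `m ≥ 0`. -/
lemma obataDefect_eq (hn : 1 ≤ n) (hN : N = m + n) (x : EuclideanSpace ℝ (Fin n)) :
    obataDefect v N b x
      = m * ∑ j, ∑ i, (pd j (pd i v) x - if j = i then 2 * b else 0) ^ 2
        + n * ∑ j, ∑ i, (pd j (pd i v) x - if j = i then lap v x / n else 0) ^ 2 := by
  have hn0 : (n : ℝ) ≠ 0 := by positivity
  rw [obataDefect, sum_sum_sub_diag_sq (fun j i => pd j (pd i v) x),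
    sum_sum_sub_diag_sq (fun j i => pd j (pd i v) x)]
  change N * (_ - _ * lap v x + _) - _ = m * (_ - _ * lap v x + _) + n * (_ - _ * lap v x + _)
  rw [hN]
  field_simp
  ring

lemma continuous_obataDefect (hv : ContDiff ℝ ∞ v) : Continuous (obataDefect v N b) := by
  have h := (contDiff_lap hv).continuous
  have h2 : ∀ i j, Continuous (pd j (pd i v)) := fun i j =>
    (contDiff_pd (contDiff_pd hv i) j).continuous
  unfold obataDefect
  fun_prop

/-- A crude bound that avoids square roots: `2 |y| ≤ y² + 1`. -/
lemma abs_le_add_one_of_sq_le {y K : ℝ} (h : y ^ 2 ≤ K) : |y| ≤ K + 1 := by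
  have := sq_abs y
  nlinarith [sq_nonneg (|y| - 1), abs_nonneg y]

/-- The boundary terms vanish. The growth of `v` and `∇v` is exactly balanced by the decay of the
cutoff derivatives, so the integrand is dominated by a multiple of the integrable `v ^ (1 - N)`, and
it is eventually zero at each point. -/
lemma tendsto_integral_mul_pd_cutoff {η : ℕ → EuclideanSpace ℝ (Fin n) → ℝ} {M : ℝ}
    (hη : IsCutoffSequence η M) (hv : ContDiff ℝ ∞ v) (hpos : ∀ x, 0 < v x)
    (hint : Integrable fun x => v x ^ (1 - N)) {C : ℝ}
    (hC : ∀ x, v x ≤ C * (1 + ‖x‖ ^ 2)) (hC' : ∀ i x, pd i v x ^ 2 ≤ C * (1 + ‖x‖ ^ 2))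
    {f : EuclideanSpace ℝ (Fin n) → ℝ} (hf : Continuous f) {F : ℝ} (hF : ∀ x, |f x| ≤ F)
    (j : Fin n) :
    Tendsto (fun k => ∫ x, f x * pd j (fun y => v y ^ (2 - N) * pd j (η k) y) x) atTop (𝓝 0) := by
  have dv : Differentiable ℝ v := hv.differentiable (by simp)
  have hC0 : 0 ≤ C := by
    have := (hpos 0).le.trans (hC 0)
    simpa using this
  have hM0 : 0 ≤ M := by
    have := hη.pd_sq_le 0 j 0
    refine le_trans ?_ this
    positivity
  have hF0 : 0 ≤ F := (abs_nonneg _).trans (hF 0)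
  have e : ∀ k x, pd j (fun y => v y ^ (2 - N) * pd j (η k) y) x
      = v x ^ (1 - N) * (v x * pd j (pd j (η k)) x + (2 - N) * (pd j v x * pd j (η k) x)) := by
    intro k x
    have hk := contDiff_pd (hη.contDiff k) j
    rw [pd_mul ((contDiff_rpow hv hpos _).differentiable (by simp)) (hk.differentiable (by simp)),
      pd_rpow dv hpos, show 2 - N - 1 = 1 - N by ring, show 2 - N = 1 - N + 1 by ring,
      Real.rpow_add_one (hpos x).ne']
    ring
  have hb1 : ∀ k x, |v x * pd j (pd j (η k)) x| ≤ C * M := by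
    intro k x
    rw [abs_mul, abs_of_pos (hpos x)]
    calc v x * |pd j (pd j (η k)) x|
        ≤ C * (1 + ‖x‖ ^ 2) * |pd j (pd j (η k)) x| :=
          mul_le_mul_of_nonneg_right (hC x) (abs_nonneg _)
      _ = C * (|pd j (pd j (η k)) x| * (1 + ‖x‖ ^ 2)) := by ring
      _ ≤ C * M := mul_le_mul_of_nonneg_left (hη.pd_pd_le k j x) hC0
  have hb2 : ∀ k x, |pd j v x * pd j (η k) x| ≤ C * M + 1 := by
    intro k x
    apply abs_le_add_one_of_sq_le
    calc (pd j v x * pd j (η k) x) ^ 2 = pd j v x ^ 2 * pd j (η k) x ^ 2 := by ring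
      _ ≤ C * (1 + ‖x‖ ^ 2) * pd j (η k) x ^ 2 :=
          mul_le_mul_of_nonneg_right (hC' j x) (sq_nonneg _)
      _ = C * (pd j (η k) x ^ 2 * (1 + ‖x‖ ^ 2)) := by ring
      _ ≤ C * M := mul_le_mul_of_nonneg_left (hη.pd_sq_le k j x) hC0
  rw [show (0 : ℝ) = ∫ _ : EuclideanSpace ℝ (Fin n), (0 : ℝ) by simp]
  refine tendsto_integral_of_dominated_convergence
    (fun x => F * (C * M + |2 - N| * (C * M + 1)) * v x ^ (1 - N)) ?_ (hint.const_mul _) ?_ ?_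
  · intro k
    exact (hf.mul (contDiff_pd ((contDiff_rpow hv hpos _).mul
      (contDiff_pd (hη.contDiff k) j)) j).continuous).aestronglyMeasurable
  · refine fun k => ae_of_all _ fun x => ?_
    rw [e, Real.norm_eq_abs, abs_mul, abs_mul, abs_of_pos (Real.rpow_pos_of_pos (hpos x) _)]
    have h1 : |v x * pd j (pd j (η k)) x + (2 - N) * (pd j v x * pd j (η k) x)|
        ≤ C * M + |2 - N| * (C * M + 1) := by
      refine (abs_add_le _ _).trans (add_le_add (hb1 k x) ?_)
      rw [abs_mul]
      exact mul_le_mul_of_nonneg_left (hb2 k x) (abs_nonneg _)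
    have hr := (Real.rpow_pos_of_pos (hpos x) (1 - N)).le
    calc |f x| * (v x ^ (1 - N) * |v x * pd j (pd j (η k)) x
          + (2 - N) * (pd j v x * pd j (η k) x)|)
        ≤ F * (v x ^ (1 - N) * (C * M + |2 - N| * (C * M + 1))) :=
          mul_le_mul (hF x) (mul_le_mul_of_nonneg_left h1 hr)
            (mul_nonneg hr (abs_nonneg _)) hF0
      _ = _ := by ring
  · refine ae_of_all _ fun x => tendsto_const_nhds.congr' ?_
    filter_upwards [hη.eventually_pd x, hη.eventually_pd_pd x] with k h1 h2
    rw [e, h1, h2]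
    ring

/-- Two integrations by parts put both derivatives on the cutoff. Applied to `f = Δv`, this requires
a bound on `Δv` only, and none on its gradient. -/
lemma integral_cutoff_mul_pd_pd {η : EuclideanSpace ℝ (Fin n) → ℝ}
    (hη : ContDiff ℝ ∞ η) (hηc : HasCompactSupport η) {ρ f : EuclideanSpace ℝ (Fin n) → ℝ}
    (hρ : ContDiff ℝ ∞ ρ) (hf : ContDiff ℝ ∞ f) (j : Fin n) :
    ∫ x, η x * pd j (fun y => ρ y * pd j f y) x
      = ∫ x, f x * pd j (fun y => ρ y * pd j η y) x := by
  have h1 := integral_mul_pd (hρ.mul (contDiff_pd hf j)) hη hηc j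
  have h2 := integral_mul_pd hf (hρ.mul (contDiff_pd hη j))
    (hasCompactSupport_pd hηc j).mul_left j
  rw [h2]
  have e : ∫ x, η x * pd j (fun y => ρ y * pd j f y) x
      = ∫ x, pd j (fun y => ρ y * pd j f y) x * η x := by
    congr 1; ext x; ring
  rw [e, ← neg_eq_iff_eq_neg.mpr h1]
  congr 1
  refine integral_congr_ae (ae_of_all _ fun x => ?_)
  change ρ x * pd j f x * pd j η x = pd j f x * (ρ x * pd j η x)
  ring

/-- The divergence structure behind Obata's argument. -/
lemma rpow_mul_obataDefect (hN : N = m + n) (hv : ContDiff ℝ ∞ v) (hpos : ∀ x, 0 < v x)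
    (heq : ∀ x, v x * lap v x = N / 2 * ∑ i, pd i v x * pd i v x + c₂ - 2 * m * b * v x)
    (x : EuclideanSpace ℝ (Fin n)) :
    v x ^ (1 - N) * obataDefect v N b x
      = ∑ j, pd j (fun y => v y ^ (2 - N) * pd j (lap v) y) x
        - 2 * m * b * (v x ^ (1 - N) * (lap v x - 2 * n * b)) := by
  have dv : Differentiable ℝ v := hv.differentiable (by simp)
  have e : ∀ j, pd j (fun y => v y ^ (2 - N) * pd j (lap v) y) x
      = v x ^ (1 - N) * (v x * pd j (pd j (lap v)) x - (N - 2) * (pd j v x * pd j (lap v) x)) := by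
    intro j
    have hk := contDiff_pd (contDiff_lap hv) j
    rw [pd_mul ((contDiff_rpow hv hpos _).differentiable (by simp)) (hk.differentiable (by simp)),
      pd_rpow dv hpos, show 2 - N - 1 = 1 - N by ring, show 2 - N = 1 - N + 1 by ring,
      Real.rpow_add_one (hpos x).ne']
    ring
  simp_rw [e]
  rw [← Finset.mul_sum, Finset.sum_sub_distrib, ← Finset.mul_sum, ← Finset.mul_sum]
  have h := mul_lap_lap_eq_obataDefect hN hv heq x
  change _ = _ * (v x * lap (lap v) x - _) - _
  rw [h]
  ring

/-- Both nonnegative summands of the defect vanish. The factor `m` stays in the second conclusion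
because for `m = 0` that summand carries no information. -/
lemma pd_pd_eq_of_obataDefect_eq_zero (hn : 1 ≤ n) (hm : 0 ≤ m) (hN : N = m + n)
    {x : EuclideanSpace ℝ (Fin n)} (h : obataDefect v N b x = 0) (i j : Fin n) :
    pd j (pd i v) x = (if j = i then lap v x / n else 0) ∧
      m * (pd j (pd i v) x - if j = i then 2 * b else 0) = 0 := by
  rw [obataDefect_eq hn hN] at h
  have hn0 : (0 : ℝ) < n := by positivity
  have key : ∀ B : Fin n → Fin n → ℝ, ∑ j, ∑ i, B j i ^ 2 = 0 → B j i = 0 := by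
    intro B hB
    rw [Finset.sum_eq_zero_iff_of_nonneg
      fun a _ => Finset.sum_nonneg fun c _ => sq_nonneg _] at hB
    have := hB j (Finset.mem_univ j)
    rw [Finset.sum_eq_zero_iff_of_nonneg fun c _ => sq_nonneg _] at this
    exact pow_eq_zero_iff two_ne_zero |>.mp (this i (Finset.mem_univ i))
  have nn : ∀ B : Fin n → Fin n → ℝ, 0 ≤ ∑ j, ∑ i, B j i ^ 2 := fun B =>
    Finset.sum_nonneg fun a _ => Finset.sum_nonneg fun c _ => sq_nonneg _
  have n1 := nn fun j i => pd j (pd i v) x - if j = i then 2 * b else 0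
  have n2 := nn fun j i => pd j (pd i v) x - if j = i then lap v x / n else 0
  have z1 := mul_nonneg hm n1
  have z2 := mul_nonneg hn0.le n2
  have h1 : m * ∑ j, ∑ i, (pd j (pd i v) x - if j = i then 2 * b else 0) ^ 2 = 0 := by linarith
  have h2 : (n : ℝ) * ∑ j, ∑ i, (pd j (pd i v) x - if j = i then lap v x / n else 0) ^ 2 = 0 := by
    linarith
  constructor
  · have := key (fun j i => pd j (pd i v) x - if j = i then lap v x / n else 0)
      ((mul_eq_zero.mp h2).resolve_left hn0.ne')
    linarith
  · rcases mul_eq_zero.mp h1 with h | h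
    · rw [h, zero_mul]
    · have := key (fun j i => pd j (pd i v) x - if j = i then 2 * b else 0) h
      rw [this, mul_zero]

/-- An Obata-type rigidity theorem for positive solutions of the conformally transformed
Euler--Lagrange equation. -/
theorem pd_pd_eq_of_equation (hn : 1 ≤ n) (hm : 0 ≤ m) (hN : N = m + n)
    (hv : ContDiff ℝ ∞ v) (hpos : ∀ x, 0 < v x)
    (heq : ∀ x, v x * lap v x = N / 2 * ∑ i, pd i v x * pd i v x + c₂ - 2 * m * b * v x)
    (hint : Integrable fun x => v x ^ (1 - N)) {C : ℝ}
    (hC : ∀ x, v x ≤ C * (1 + ‖x‖ ^ 2)) (hC' : ∀ i x, pd i v x ^ 2 ≤ C * (1 + ‖x‖ ^ 2))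
    {F : ℝ} (hF : ∀ x, |lap v x| ≤ F)
    (hzero : ∫ x, v x ^ (1 - N) * (lap v x - 2 * n * b) = 0)
    (i j : Fin n) (x : EuclideanSpace ℝ (Fin n)) :
    pd j (pd i v) x = if j = i then 2 * b else 0 := by
  obtain ⟨η, M, hη⟩ := exists_isCutoffSequence n
  have hl := contDiff_lap hv
  have dl : Differentiable ℝ (lap v) := hl.differentiable (by simp)
  have hn0 : (0 : ℝ) < n := by positivity
  have hρ : ∀ r : ℝ, ContDiff ℝ ∞ fun y => v y ^ r := contDiff_rpow hv hpos
  have hweight : Integrable fun x => v x ^ (1 - N) * (lap v x - 2 * n * b) := by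
    refine hint.mul_bdd (c := F + |2 * n * b|)
      (hl.continuous.sub continuous_const).aestronglyMeasurable (ae_of_all _ fun x => ?_)
    exact (abs_sub _ _).trans (add_le_add (hF x) le_rfl)
  have hlim : Tendsto (fun k => ∫ x, η k x * (v x ^ (1 - N) * obataDefect v N b x))
      atTop (𝓝 0) := by
    -- The divergence identity tested against the cutoff: the first sum tends to zero by the decay
    -- estimate, the second term by `hzero`.
    have e : ∀ k, ∫ x, η k x * (v x ^ (1 - N) * obataDefect v N b x)
        = (∑ j, ∫ x, lap v x * pd j (fun y => v y ^ (2 - N) * pd j (η k) y) x)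
          - 2 * m * b * ∫ x, η k x * (v x ^ (1 - N) * (lap v x - 2 * n * b)) := by
      intro k
      have hηk := hη.contDiff k
      have hcs := hη.compact k
      simp_rw [← integral_cutoff_mul_pd_pd hηk hcs (hρ (2 - N)) hl, rpow_mul_obataDefect hN hv
        hpos heq]
      have i1 : ∀ j, Integrable fun x =>
          η k x * pd j (fun y => v y ^ (2 - N) * pd j (lap v) y) x := fun j =>
        (hηk.continuous.mul (contDiff_pd ((hρ _).mul (contDiff_pd hl j)) j).continuous
          ).integrable_of_hasCompactSupport hcs.mul_right
      have i2 : Integrable fun x => η k x * (v x ^ (1 - N) * (lap v x - 2 * n * b)) :=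
        (hηk.continuous.mul ((hρ _).continuous.mul (hl.continuous.sub continuous_const))
          ).integrable_of_hasCompactSupport hcs.mul_right
      rw [← integral_finsetSum _ fun j _ => i1 j, ← integral_const_mul,
        ← integral_sub (integrable_finsetSum _ fun j _ => i1 j) (i2.const_mul _)]
      refine integral_congr_ae (ae_of_all _ fun x => ?_)
      simp only [← Finset.mul_sum]
      ring
    simp_rw [e]
    have t1 := tendsto_finsetSum (Finset.univ : Finset (Fin n)) fun j _ =>
      tendsto_integral_mul_pd_cutoff hη hv hpos hint hC hC' hl.continuous hF j
    have t2 := (hη.tendsto_integral_mul hweight).const_mul (2 * m * b)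
    rw [hzero] at t2
    simpa using t1.sub t2
  have hdef : ∀ x, obataDefect v N b x = 0 := by
    have nn : ∀ x, 0 ≤ obataDefect v N b x := by
      intro x
      rw [obataDefect_eq hn hN]
      have : ∀ B : Fin n → Fin n → ℝ, 0 ≤ ∑ j, ∑ i, B j i ^ 2 := fun B =>
        Finset.sum_nonneg fun a _ => Finset.sum_nonneg fun c _ => sq_nonneg _
      exact add_nonneg (mul_nonneg hm (this _)) (mul_nonneg hn0.le (this _))
    have h0 := hη.eq_zero_of_tendsto
      (F := fun x => v x ^ (1 - N) * obataDefect v N b x)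
      ((hρ _).continuous.mul (continuous_obataDefect hv))
      (fun x => mul_nonneg (Real.rpow_pos_of_pos (hpos x) _).le (nn x)) hlim
    exact fun x => (mul_eq_zero.mp (h0 x)).resolve_left (Real.rpow_pos_of_pos (hpos x) _).ne'
  -- With a pure-trace Hessian the differentiated equation reads `v ∂ⱼΔv = m (Δv/n - 2b) ∂ⱼv`, whose
  -- right side vanishes. This treats `m = 0` and `m > 0` at once.
  have hgrad : ∀ j x, pd j (lap v) x = 0 := by
    intro j x
    have h := mul_pd_lap hv heq j x
    have hh := fun i => (pd_pd_eq_of_obataDefect_eq_zero hn hm hN (hdef x) i j).1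
    simp_rw [hh] at h
    simp only [mul_ite, mul_zero, Finset.sum_ite_eq, Finset.mem_univ, if_true] at h
    have h2 := (pd_pd_eq_of_obataDefect_eq_zero hn hm hN (hdef x) j j).2
    rw [hh j] at h2
    simp only [if_true] at h2
    have h3 : v x * pd j (lap v) x = 0 := by
      rw [h, hN]
      have : m * (lap v x / n) = m * (2 * b) := by linarith
      have h4 : (n : ℝ) * (lap v x / n) = lap v x := by field_simp
      linear_combination pd j v x * this + pd j v x * h4
    exact (mul_eq_zero.mp h3).resolve_left (hpos x).ne'
  have hconst : ∀ y, lap v y = lap v x := fun y => eq_of_pd_eq_zero dl hgrad y x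
  -- A constant whose integral against a positive weight vanishes is zero; this identifies `Δv` with
  -- `2 n b` even when `m = 0`.
  simp_rw [hconst, integral_mul_const] at hzero
  have hposint := integral_rpow_pos hpos hint
  have hval : lap v x = 2 * n * b := by
    have := (mul_eq_zero.mp hzero).resolve_left hposint.ne'
    linarith
  rw [(pd_pd_eq_of_obataDefect_eq_zero hn hm hN (hdef x) i j).1, hval]
  congr 1
  field_simp

end Obata

/-! ### Quadratic growth from regularity at infinity. -/

section Kelvin

variable {n : ℕ}

lemma exists_pos_le_of_continuous {f : EuclideanSpace ℝ (Fin n) → ℝ} (hf : Continuous f)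
    (hpos : ∀ x, 0 < f x) (r : ℝ) : ∃ c, 0 < c ∧ ∀ x, ‖x‖ ≤ r → c ≤ f x := by
  obtain ⟨K, hK⟩ := (isCompact_closedBall (0 : EuclideanSpace ℝ (Fin n)) r
    ).exists_bound_of_continuousOn (hf.inv₀ fun x => (hpos x).ne').continuousOn
  refine ⟨(|K| + 1)⁻¹, by positivity, fun x hx => ?_⟩
  have h : ‖(f x)⁻¹‖ ≤ K := hK x (by simpa using hx)
  rw [Real.norm_eq_abs, abs_of_pos (inv_pos.mpr (hpos x))] at h
  rw [inv_le_comm₀ (by positivity) (hpos x)]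
  linarith [le_abs_self K]

lemma exists_le_of_continuous {F : Type*} [NormedAddCommGroup F]
    {f : EuclideanSpace ℝ (Fin n) → F} (hf : Continuous f) (r : ℝ) :
    ∃ C, 0 ≤ C ∧ ∀ x, ‖x‖ ≤ r → ‖f x‖ ≤ C := by
  obtain ⟨K, hK⟩ := (isCompact_closedBall (0 : EuclideanSpace ℝ (Fin n)) r
    ).exists_bound_of_continuousOn hf.continuousOn
  exact ⟨|K|, abs_nonneg _, fun x hx => (hK x (by simpa using hx)).trans (le_abs_self K)⟩

lemma norm_inversion_zero_one (x : EuclideanSpace ℝ (Fin n)) :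
    ‖EuclideanGeometry.inversion 0 1 x‖ = ‖x‖⁻¹ := by
  have h := EuclideanGeometry.dist_inversion_center (0 : EuclideanSpace ℝ (Fin n)) x 1
  simpa using h

lemma inversion_zero_one (x : EuclideanSpace ℝ (Fin n)) :
    EuclideanGeometry.inversion 0 1 x = (‖x‖ ^ 2)⁻¹ • x := by
  simp [EuclideanGeometry.inversion]

/-- A function that is conformally equivalent to a `C¹` function near infinity has quadratic
growth. -/
lemma quadratic_growth_of_inversion {v V : EuclideanSpace ℝ (Fin n) → ℝ}
    (hv : ContDiff ℝ 1 v) (hvpos : ∀ x, 0 < v x) (hV : ContDiff ℝ 1 V) (hVpos : ∀ x, 0 < V x)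
    (h : ∀ x, x ≠ 0 → v x = ‖x‖ ^ 2 * V (EuclideanGeometry.inversion 0 1 x)) :
    ∃ c C, 0 < c ∧ (∀ x, c * (1 + ‖x‖ ^ 2) ≤ v x) ∧ (∀ x, v x ≤ C * (1 + ‖x‖ ^ 2)) ∧
      ∀ i x, pd i v x ^ 2 ≤ C * (1 + ‖x‖ ^ 2) := by
  obtain ⟨c₁, hc₁, hc₁'⟩ := exists_pos_le_of_continuous hv.continuous hvpos 1
  obtain ⟨c₂, hc₂, hc₂'⟩ := exists_pos_le_of_continuous hV.continuous hVpos 1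
  obtain ⟨C₁, hC₁, hC₁'⟩ := exists_le_of_continuous hv.continuous 1
  obtain ⟨C₂, hC₂, hC₂'⟩ := exists_le_of_continuous hV.continuous 1
  obtain ⟨C₃, hC₃, hC₃'⟩ := exists_le_of_continuous (hv.continuous_fderiv (by simp)) 1
  obtain ⟨C₄, hC₄, hC₄'⟩ := exists_le_of_continuous (hV.continuous_fderiv (by simp)) 1
  have hfar : ∀ x : EuclideanSpace ℝ (Fin n), ¬ ‖x‖ ≤ 1 →
      x ≠ 0 ∧ ‖EuclideanGeometry.inversion (0 : EuclideanSpace ℝ (Fin n)) 1 x‖ ≤ 1 := by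
    intro x hx
    push Not at hx
    refine ⟨fun h0 => ?_, ?_⟩
    · rw [h0, norm_zero] at hx
      linarith
    · rw [norm_inversion_zero_one]
      exact inv_le_one_of_one_le₀ hx.le
  -- The half comes from `1 + |x|² ≤ 2` inside the unit ball and `1 + |x|² ≤ 2 |x|²` outside. The
  -- upper constant collects the bounds of all the cases.
  refine ⟨min c₁ c₂ / 2, C₁ + C₂ + C₃ ^ 2 + (C₄ + 2 * C₂) ^ 2, by positivity, ?_, ?_, ?_⟩
  · intro x
    by_cases hx : ‖x‖ ≤ 1
    · have h1 := hc₁' x hx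
      have h2 : ‖x‖ ^ 2 ≤ 1 := pow_le_one₀ (norm_nonneg x) hx
      have h3 : min c₁ c₂ ≤ c₁ := min_le_left _ _
      have h4 : 0 < min c₁ c₂ := lt_min hc₁ hc₂
      nlinarith
    · obtain ⟨hx0, hi⟩ := hfar x hx
      rw [h x hx0]
      have h1 := hc₂' _ hi
      have h2 : 1 ≤ ‖x‖ ^ 2 := one_le_pow₀ (not_le.mp hx).le
      have h3 : min c₁ c₂ ≤ c₂ := min_le_right _ _
      have h4 : 0 < min c₁ c₂ := lt_min hc₁ hc₂
      calc min c₁ c₂ / 2 * (1 + ‖x‖ ^ 2) ≤ ‖x‖ ^ 2 * min c₁ c₂ := by nlinarith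
        _ ≤ _ := mul_le_mul_of_nonneg_left (h3.trans h1) (by positivity)
  · intro x
    have hsq : 0 ≤ C₃ ^ 2 + (C₄ + 2 * C₂) ^ 2 := by positivity
    have hx2 : 0 ≤ ‖x‖ ^ 2 := sq_nonneg _
    by_cases hx : ‖x‖ ≤ 1
    · have h1 := (le_abs_self _).trans (hC₁' x hx)
      nlinarith [mul_nonneg hC₁ hx2, mul_nonneg hC₂ hx2, mul_nonneg hsq hx2]
    · obtain ⟨hx0, hi⟩ := hfar x hx
      rw [h x hx0]
      have h1 := (le_abs_self _).trans (hC₂' _ hi)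
      have h2 := mul_le_mul_of_nonneg_left h1 hx2
      nlinarith [mul_nonneg hC₁ hx2, mul_nonneg hC₂ hx2, mul_nonneg hsq hx2]
  · intro i x
    have hx2 : 0 ≤ ‖x‖ ^ 2 := sq_nonneg _
    have hsum : 0 ≤ C₁ + C₂ := add_nonneg hC₁ hC₂
    by_cases hx : ‖x‖ ≤ 1
    · have h1 : |pd i v x| ≤ C₃ := (abs_pd_le i x).trans (hC₃' x hx)
      have h2 : pd i v x ^ 2 ≤ C₃ ^ 2 := by
        rw [← sq_abs]
        gcongr
      nlinarith [mul_nonneg hsum hx2, mul_nonneg (sq_nonneg C₃) hx2,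
        mul_nonneg (sq_nonneg (C₄ + 2 * C₂)) hx2, sq_nonneg (C₄ + 2 * C₂)]
    · obtain ⟨hx0, hi⟩ := hfar x hx
      have hx1 : 1 ≤ ‖x‖ := (not_le.mp hx).le
      have hnx : ‖x‖ ≠ 0 := by positivity
      have hinv := EuclideanGeometry.hasFDerivAt_inversion (c := (0 : EuclideanSpace ℝ (Fin n)))
        (R := 1) hx0
      have hVd := (hV.differentiable (by simp)
        (EuclideanGeometry.inversion 0 1 x)).hasFDerivAt.comp x hinv
      have hsqd := (hasStrictFDerivAt_norm_sq x).hasFDerivAt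
      have hprod := hsqd.mul hVd
      have hve : v =ᶠ[nhds x] fun y => ‖y‖ ^ 2 * V (EuclideanGeometry.inversion 0 1 y) := by
        filter_upwards [isOpen_ne.mem_nhds hx0] with y hy using h y hy
      have hfd := (hprod.congr_of_eventuallyEq hve).fderiv
      have h1 : |pd i v x| ≤ C₄ + 2 * C₂ * ‖x‖ := by
        rw [pd, hfd]
        simp only [add_apply, smul_apply,
          ContinuousLinearMap.comp_apply, smul_eq_mul, map_smul, dist_zero_right, sub_zero,
          Function.comp_apply, nsmul_eq_mul]
        refine (abs_add_le _ _).trans (add_le_add ?_ ?_)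
        -- The derivative of the inversion is `|x|⁻²` times a reflection: the factor `|x|²` cancels
        -- and the reflection preserves norms, so this term is bounded.
        · have e : ∀ z : ℝ, ‖x‖ ^ 2 * ((1 / ‖x‖) ^ 2 * z) = z := fun z => by field_simp
          rw [e]
          refine ((fderiv ℝ V _).le_opNorm _).trans ?_
          refine (mul_le_mul_of_nonneg_right (hC₄' _ hi) (norm_nonneg _)).trans_eq ?_
          simp
        · rw [abs_mul]
          have h3 := abs_real_inner_le_norm x (EuclideanSpace.single i (1 : ℝ))
          have h4 : ‖(EuclideanSpace.single i (1 : ℝ) : EuclideanSpace ℝ (Fin n))‖ = 1 := by simp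
          rw [h4, mul_one] at h3
          have h5 : |V (EuclideanGeometry.inversion 0 1 x)| ≤ C₂ := hC₂' _ hi
          simp only [innerSL_apply_apply, abs_mul]
          calc _ ≤ C₂ * (2 * ‖x‖) := by
                refine mul_le_mul h5 ?_ (by positivity) hC₂
                simpa using h3
            _ = _ := by ring
      have h2 : |pd i v x| ≤ (C₄ + 2 * C₂) * ‖x‖ := by nlinarith
      have h3 : pd i v x ^ 2 ≤ ((C₄ + 2 * C₂) * ‖x‖) ^ 2 := by
        rw [← sq_abs]
        gcongr
      nlinarith [mul_nonneg hsum hx2, mul_nonneg (sq_nonneg C₃) hx2, sq_nonneg C₃,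
        sq_nonneg (C₄ + 2 * C₂)]

/-- Inversion is an involution, and raising `|x| ^ (2 - m - n)` to the power `-1/s` yields exactly
`|x|²`. -/
lemma rpow_eq_norm_sq_mul_of_kelvinTransform {m s : ℝ} (hs : 0 < s) (hsm : m + n - 2 = 2 * s)
    {w W : EuclideanSpace ℝ (Fin n) → ℝ} (hw : ∀ x, 0 < w x)
    (h : ∀ x, x ≠ 0 → W x = kelvinTransform m w x) (x : EuclideanSpace ℝ (Fin n)) (hx : x ≠ 0) :
    w x ^ (-s⁻¹) = ‖x‖ ^ 2 * W (EuclideanGeometry.inversion 0 1 x) ^ (-s⁻¹) := by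
  have hnx : 0 < ‖x‖ := norm_pos_iff.mpr hx
  have hi : EuclideanGeometry.inversion 0 1 x ≠ 0 := by
    rw [← norm_ne_zero_iff, norm_inversion_zero_one]
    positivity
  rw [h _ hi, kelvinTransform, ← inversion_zero_one (EuclideanGeometry.inversion 0 1 x),
    EuclideanGeometry.inversion_inversion 0 one_ne_zero, norm_inversion_zero_one,
    Real.mul_rpow (by positivity) (hw x).le, ← Real.rpow_mul (by positivity),
    show (2 - m - n) * -s⁻¹ = 2 by rw [show 2 - m - n = -(2 * s) by linarith]; field_simp]
  rw [Real.rpow_two]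
  field_simp

end Kelvin

/-! ### First variation of the quotient and the Euler–Lagrange equation. -/

section Variation

open Filter Topology

variable {n : ℕ} {w ξ : EuclideanSpace ℝ (Fin n) → ℝ}

lemma weightedVolume_zero :
    weightedVolume (fun _ : EuclideanSpace ℝ (Fin n) => (0 : ℝ)) = volume := by
  simp [weightedVolume]

lemma weightedScalarCurvature_zero (m : ℝ) (x : EuclideanSpace ℝ (Fin n)) :
    weightedScalarCurvature (fun _ : EuclideanSpace ℝ (Fin n) => (0 : ℝ)) m x = 0 := by
  have h : Laplacian.laplacian (fun _ : EuclideanSpace ℝ (Fin n) => (0 : ℝ)) = 0 := by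
    ext y
    simp [InnerProductSpace.laplacian_eq_iteratedFDeriv_stdOrthonormalBasis]
  simp [weightedScalarCurvature, gradient, h]

/-- The factor `exp (φ / m)` is 1 also for `m = 0`, where `0 / 0 = 0`. -/
lemma yamabeQuotient_zero (m : ℝ) (u : EuclideanSpace ℝ (Fin n) → ℝ) :
    yamabeQuotient (fun _ => 0) m u
      = (∫ x, ∑ i, pd i u x ^ 2) * (∫ x, |u x| ^ (2 * (m + n - 1) / (m + n - 2))) ^ (2 * m / n)
        / (∫ x, |u x| ^ (2 * (m + n) / (m + n - 2))) ^ ((2 * m + n - 2) / n) := by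
  simp only [yamabeQuotient, weightedVolume_zero, weightedScalarCurvature_zero, norm_sq_gradient]
  simp

lemma hasDerivAt_integral_sum_pd_sq (hw : ContDiff ℝ ∞ w) (hξ : ContDiff ℝ ∞ ξ)
    (hξc : HasCompactSupport ξ) (hint : Integrable fun x => ∑ i, pd i w x ^ 2) :
    HasDerivAt (fun t : ℝ => ∫ x, ∑ i, pd i (fun y => w y + t * ξ y) x ^ 2)
      (2 * ∫ x, ∑ i, pd i w x * pd i ξ x) 0 := by
  have cw := fun i => (contDiff_pd hw i).continuous
  have cξ := fun i => (contDiff_pd hξ i).continuous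
  have i1 : Integrable fun x => ∑ i, pd i w x * pd i ξ x := integrable_finsetSum _ fun i _ =>
    ((cw i).mul (cξ i)).integrable_of_hasCompactSupport (hasCompactSupport_pd hξc i).mul_left
  have i2 : Integrable fun x => ∑ i, pd i ξ x * pd i ξ x := integrable_finsetSum _ fun i _ =>
    ((cξ i).mul (cξ i)).integrable_of_hasCompactSupport (hasCompactSupport_pd hξc i).mul_left
  have i3 : ∀ t : ℝ, Integrable fun x =>
      ∑ i, pd i w x ^ 2 + t * (2 * ∑ i, pd i w x * pd i ξ x) := fun t =>
    hint.add ((i1.const_mul 2).const_mul t)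
  have e : ∀ t : ℝ, ∫ x, ∑ i, pd i (fun y => w y + t * ξ y) x ^ 2
      = (∫ x, ∑ i, pd i w x ^ 2) + t * (2 * ∫ x, ∑ i, pd i w x * pd i ξ x)
        + t ^ 2 * ∫ x, ∑ i, pd i ξ x * pd i ξ x := by
    intro t
    rw [← integral_const_mul, ← integral_const_mul, ← integral_const_mul,
      ← integral_add hint ((i1.const_mul 2).const_mul t),
      ← integral_add (i3 t) (i2.const_mul _)]
    refine integral_congr_ae (ae_of_all _ fun x => ?_)
    have dξ : Differentiable ℝ ξ := hξ.differentiable (by simp)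
    simp only [Finset.mul_sum, ← Finset.sum_add_distrib]
    refine Finset.sum_congr rfl fun i _ => ?_
    rw [pd_add (hw.differentiable (by simp)) (by fun_prop), pd_const_mul dξ]
    ring
  simp_rw [e]
  have h := (((hasDerivAt_id (0 : ℝ)).mul_const (2 * ∫ x, ∑ i, pd i w x * pd i ξ x)).const_add
    (∫ x, ∑ i, pd i w x ^ 2)).add
    (((hasDerivAt_id (0 : ℝ)).pow 2).mul_const (∫ x, ∑ i, pd i ξ x * pd i ξ x))
  exact h.congr_deriv (by simp)

/-- The quotient `ξ / w` is continuous with compact support, hence bounded. Small variations thus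
stay positive, and the absolute values in the quotient play no role. -/
lemma exists_pos_mul_abs_le (hw : Continuous w) (hpos : ∀ x, 0 < w x) (hξ : Continuous ξ)
    (hξc : HasCompactSupport ξ) :
    ∃ ε, 0 < ε ∧ ∀ t ∈ Metric.ball (0 : ℝ) ε, ∀ x, |t * ξ x| ≤ w x / 2 := by
  have hc : HasCompactSupport fun x => ξ x * (w x)⁻¹ := hξc.mul_right
  obtain ⟨K, hK⟩ := hc.exists_bound_of_continuous (hξ.mul (hw.inv₀ fun x => (hpos x).ne'))
  refine ⟨(2 * (|K| + 1))⁻¹, by positivity, fun t ht x => ?_⟩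
  have h1 := hK x
  have hwx := hpos x
  rw [Real.norm_eq_abs, abs_mul, abs_of_pos (inv_pos.mpr hwx), ← div_eq_mul_inv,
    div_le_iff₀ hwx] at h1
  rw [mem_ball_zero_iff, Real.norm_eq_abs] at ht
  have h2 : |ξ x| ≤ (|K| + 1) * w x := h1.trans (by nlinarith [le_abs_self K])
  rw [abs_mul]
  calc |t| * |ξ x| ≤ (2 * (|K| + 1))⁻¹ * ((|K| + 1) * w x) :=
        mul_le_mul ht.le h2 (abs_nonneg _) (by positivity)
    _ = w x / 2 := by field_simp

/-- Differentiation under the integral: `0 < w + tξ ≤ 2w` for small `t`, so the derivative is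
dominated by a continuous function supported in the support of `ξ`. -/
lemma hasDerivAt_integral_abs_rpow (hw : ContDiff ℝ ∞ w) (hpos : ∀ x, 0 < w x)
    (hξ : ContDiff ℝ ∞ ξ) (hξc : HasCompactSupport ξ) {r : ℝ} (hr : 1 ≤ r)
    (hint : Integrable fun x => w x ^ r) :
    HasDerivAt (fun t : ℝ => ∫ x, |w x + t * ξ x| ^ r) (r * ∫ x, w x ^ (r - 1) * ξ x) 0 := by
  obtain ⟨ε, hε, hsmall⟩ := exists_pos_mul_abs_le hw.continuous hpos hξ.continuous hξc
  have hp : ∀ t ∈ Metric.ball (0 : ℝ) ε, ∀ x, 0 < w x + t * ξ x ∧ w x + t * ξ x ≤ 2 * w x := by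
    intro t ht x
    have h1 := abs_le.mp (hsmall t ht x)
    have h2 := hpos x
    constructor <;> linarith [h1.1, h1.2]
  have h0 : (0 : ℝ) ∈ Metric.ball (0 : ℝ) ε := Metric.mem_ball_self hε
  have hcr : ∀ r : ℝ, Continuous fun x => w x ^ r := fun r =>
    (contDiff_rpow hw hpos r).continuous
  have key := hasDerivAt_integral_of_dominated_loc_of_deriv_le (μ := volume)
    (F := fun (t : ℝ) x => (w x + t * ξ x) ^ r)
    (F' := fun (t : ℝ) x => r * (w x + t * ξ x) ^ (r - 1) * ξ x)
    (bound := fun x => r * (2 ^ (r - 1) * w x ^ (r - 1)) * |ξ x|) (x₀ := (0 : ℝ))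
    (Metric.ball_mem_nhds 0 hε) ?_ ?_ ?_ ?_ ?_ ?_
  · have h := key.2
    have e1 : (fun t : ℝ => ∫ x, |w x + t * ξ x| ^ r)
        =ᶠ[𝓝 0] fun t : ℝ => ∫ x, (w x + t * ξ x) ^ r := by
      filter_upwards [Metric.ball_mem_nhds 0 hε] with t ht
      refine integral_congr_ae (ae_of_all _ fun x => ?_)
      simp only
      rw [abs_of_pos (hp t ht x).1]
    refine (h.congr_of_eventuallyEq e1).congr_deriv ?_
    rw [← integral_const_mul]
    refine integral_congr_ae (ae_of_all _ fun x => ?_)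
    simp [mul_assoc]
  · filter_upwards [Metric.ball_mem_nhds 0 hε] with t ht
    exact (((hw.continuous.add (continuous_const.mul hξ.continuous)).rpow_const
      fun x => Or.inl (hp t ht x).1.ne')).aestronglyMeasurable
  · simpa using hint
  · simp only [zero_mul, add_zero]
    exact ((continuous_const.mul (hcr _)).mul hξ.continuous).aestronglyMeasurable
  · refine ae_of_all _ fun x t ht => ?_
    obtain ⟨h1, h2⟩ := hp t ht x
    have hr0 : 0 ≤ r := by linarith
    rw [norm_mul, Real.norm_eq_abs, Real.norm_eq_abs, abs_mul, abs_of_nonneg hr0,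
      abs_of_pos (Real.rpow_pos_of_pos h1 _), ← Real.mul_rpow (by norm_num) (hpos x).le]
    have h3 : (w x + t * ξ x) ^ (r - 1) ≤ (2 * w x) ^ (r - 1) :=
      Real.rpow_le_rpow h1.le h2 (by linarith)
    gcongr
  · exact ((continuous_const.mul (continuous_const.mul (hcr _))).mul
      hξ.continuous.abs).integrable_of_hasCompactSupport hξc.abs.mul_left
  · refine ae_of_all _ fun x t ht => ?_
    have h1 : HasDerivAt (fun t : ℝ => w x + t * ξ x) (ξ x) t := by
      simpa using ((hasDerivAt_id t).mul_const (ξ x)).const_add (w x)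
    exact (h1.rpow_const (p := r) (Or.inl (hp t ht x).1.ne')).congr_deriv (by ring)

lemma weak_eulerLagrange {m p q : ℝ} (hp : p = 2 * (m + n - 1) / (m + n - 2))
    (hq : q = 2 * (m + n) / (m + n - 2)) (hp1 : 1 ≤ p) (hq1 : 1 ≤ q)
    (hw : ContDiff ℝ ∞ w) (hpos : ∀ x, 0 < w x)
    (hcrit : IsCriticalPoint (yamabeQuotient (fun _ : EuclideanSpace ℝ (Fin n) => (0 : ℝ)) m) w)
    (hA : Integrable fun x => ∑ i, pd i w x ^ 2) (hB : Integrable fun x => w x ^ p)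
    (hC : Integrable fun x => w x ^ q) (hξ : ContDiff ℝ ∞ ξ) (hξc : HasCompactSupport ξ) :
    2 * ∫ x, ∑ i, pd i w x * pd i ξ x
      = (∫ x, ∑ i, pd i w x ^ 2) * ((2 * m + n - 2) / n) * q / (∫ x, w x ^ q)
          * (∫ x, w x ^ (q - 1) * ξ x)
        - (∫ x, ∑ i, pd i w x ^ 2) * (2 * m / n) * p / (∫ x, w x ^ p)
          * ∫ x, w x ^ (p - 1) * ξ x := by
  have h0 := hcrit ξ hξ hξc
  simp_rw [yamabeQuotient_zero, ← hp, ← hq] at h0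
  have dA := hasDerivAt_integral_sum_pd_sq hw hξ hξc hA
  have dB := hasDerivAt_integral_abs_rpow hw hpos hξ hξc hp1 hB
  have dC := hasDerivAt_integral_abs_rpow hw hpos hξ hξc hq1 hC
  have eA : ∫ x, ∑ i, pd i (fun y => w y + 0 * ξ y) x ^ 2 = ∫ x, ∑ i, pd i w x ^ 2 := by simp
  have eB : ∀ r : ℝ, ∫ x, |w x + 0 * ξ x| ^ r = ∫ x, w x ^ r := by
    intro r
    simp only [zero_mul, add_zero, abs_of_pos (hpos _)]
  have pB := integral_rpow_pos hpos hB
  have pC := integral_rpow_pos hpos hC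
  set A := ∫ x, ∑ i, pd i w x ^ 2
  set B := ∫ x, w x ^ p
  set C := ∫ x, w x ^ q
  set α := 2 * m / n
  set β := (2 * m + n - 2) / n
  have dBα := dB.rpow_const (p := α) (Or.inl (by rw [eB]; exact pB.ne'))
  have dCβ := dC.rpow_const (p := β) (Or.inl (by rw [eB]; exact pC.ne'))
  have hq' := (dA.mul dBα).div dCβ (by rw [eB]; positivity)
  have hz := hq'.unique h0
  simp only [Pi.mul_apply, eA, eB] at hz
  rw [div_eq_zero_iff, or_iff_left (by positivity)] at hz
  change (_ * B ^ α + A * (_ * α * B ^ (α - 1))) * C ^ β - A * B ^ α * (_ * β * C ^ (β - 1)) = 0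
    at hz
  have hBα : B ^ α = B ^ (α - 1) * B := by rw [← Real.rpow_add_one pB.ne', sub_add_cancel]
  have hCβ : C ^ β = C ^ (β - 1) * C := by rw [← Real.rpow_add_one pC.ne', sub_add_cancel]
  have hB' : 0 < B ^ (α - 1) := Real.rpow_pos_of_pos pB _
  have hC' : 0 < C ^ (β - 1) := Real.rpow_pos_of_pos pC _
  rw [hBα, hCβ] at hz
  set I := ∫ x, ∑ i, pd i w x * pd i ξ x
  set J := ∫ x, w x ^ (p - 1) * ξ x
  set K := ∫ x, w x ^ (q - 1) * ξ x
  -- Pulling out these positive powers leaves an identity that is linear in the three first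
  -- variations.
  have hz' : B ^ (α - 1) * C ^ (β - 1)
      * (2 * I * B * C + A * p * J * α * C - A * B * q * K * β) = 0 := by
    linear_combination hz
  have hz'' := (mul_eq_zero.mp hz').resolve_left (by positivity)
  have pB' := pB.ne'
  have pC' := pC.ne'
  field_simp
  linear_combination hz''

lemma integral_sum_pd_mul_pd (hw : ContDiff ℝ ∞ w) (hξ : ContDiff ℝ ∞ ξ)
    (hξc : HasCompactSupport ξ) :
    ∫ x, ∑ i, pd i w x * pd i ξ x = - ∫ x, lap w x * ξ x := by
  have cw := fun i => contDiff_pd hw i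
  have i1 : ∀ i, Integrable fun x => pd i w x * pd i ξ x := fun i =>
    ((cw i).continuous.mul (contDiff_pd hξ i).continuous).integrable_of_hasCompactSupport
      (hasCompactSupport_pd hξc i).mul_left
  have i2 : ∀ i, Integrable fun x => pd i (pd i w) x * ξ x := fun i =>
    ((contDiff_pd (cw i) i).continuous.mul hξ.continuous).integrable_of_hasCompactSupport
      hξc.mul_left
  simp_rw [lap, Finset.sum_mul]
  rw [integral_finsetSum _ fun i _ => i1 i, integral_finsetSum _ fun i _ => i2 i,
    ← Finset.sum_neg_distrib]
  exact Finset.sum_congr rfl fun i _ => integral_mul_pd (cw i) hξ hξc i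

/-- The Euler--Lagrange equation of the weighted Yamabe quotient on flat space. -/
theorem eulerLagrange {m p q : ℝ} (hp : p = 2 * (m + n - 1) / (m + n - 2))
    (hq : q = 2 * (m + n) / (m + n - 2)) (hp1 : 1 ≤ p) (hq1 : 1 ≤ q)
    (hw : ContDiff ℝ ∞ w) (hpos : ∀ x, 0 < w x)
    (hcrit : IsCriticalPoint (yamabeQuotient (fun _ : EuclideanSpace ℝ (Fin n) => (0 : ℝ)) m) w)
    (hA : Integrable fun x => ∑ i, pd i w x ^ 2) (hB : Integrable fun x => w x ^ p)
    (hC : Integrable fun x => w x ^ q) (x : EuclideanSpace ℝ (Fin n)) :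
    2 * lap w x
      = (∫ x, ∑ i, pd i w x ^ 2) * (2 * m / n) * p / (∫ x, w x ^ p) * w x ^ (p - 1)
        - (∫ x, ∑ i, pd i w x ^ 2) * ((2 * m + n - 2) / n) * q / (∫ x, w x ^ q)
          * w x ^ (q - 1) := by
  set K₁ := (∫ x, ∑ i, pd i w x ^ 2) * (2 * m / n) * p / (∫ x, w x ^ p)
  set K₂ := (∫ x, ∑ i, pd i w x ^ 2) * ((2 * m + n - 2) / n) * q / (∫ x, w x ^ q)
  have cl := (contDiff_lap hw).continuous
  have c1 : ∀ r : ℝ, Continuous fun x => w x ^ r := fun r => (contDiff_rpow hw hpos r).continuous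
  have hcont : Continuous fun x => 2 * lap w x - K₁ * w x ^ (p - 1) + K₂ * w x ^ (q - 1) :=
    ((continuous_const.mul cl).sub (continuous_const.mul (c1 _))).add (continuous_const.mul (c1 _))
  -- Fundamental lemma of the calculus of variations; continuity then upgrades almost everywhere to
  -- everywhere.
  have hae := ae_eq_zero_of_integral_contDiff_smul_eq_zero (μ := volume)
    (hcont.locallyIntegrable) fun ξ hξ hξc => by
      have h := weak_eulerLagrange hp hq hp1 hq1 hw hpos hcrit hA hB hC hξ hξc
      rw [integral_sum_pd_mul_pd hw hξ hξc] at h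
      have i1 : Integrable fun x => lap w x * ξ x :=
        (cl.mul hξ.continuous).integrable_of_hasCompactSupport hξc.mul_left
      have i2 : ∀ r : ℝ, Integrable fun x => w x ^ r * ξ x := fun r =>
        ((c1 r).mul hξ.continuous).integrable_of_hasCompactSupport hξc.mul_left
      have i3 : Integrable fun x => 2 * (lap w x * ξ x) - K₁ * (w x ^ (p - 1) * ξ x) :=
        (i1.const_mul 2).sub ((i2 _).const_mul K₁)
      have e : ∫ x, ξ x • (2 * lap w x - K₁ * w x ^ (p - 1) + K₂ * w x ^ (q - 1))
          = 2 * (∫ x, lap w x * ξ x) - K₁ * (∫ x, w x ^ (p - 1) * ξ x)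
            + K₂ * ∫ x, w x ^ (q - 1) * ξ x := by
        rw [← integral_const_mul, ← integral_const_mul, ← integral_const_mul,
          ← integral_sub (i1.const_mul 2) ((i2 _).const_mul K₁),
          ← integral_add i3 ((i2 _).const_mul K₂)]
        refine integral_congr_ae (ae_of_all _ fun x => ?_)
        simp only [smul_eq_mul]
        ring
      rw [e]
      linear_combination -h
  have hall := congrFun ((hcont.ae_eq_iff_eq volume continuous_const).mp hae) x
  linear_combination hall

end Variation

/-! ### The equation for `v`, and functions whose Hessian is a constant multiple of the identity. -/

section Classification

variable {n : ℕ}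

/-- The Euler--Lagrange equation in terms of `v`, where `w = v ^ (-s)`. -/
lemma equation_of_rpow {w v : EuclideanSpace ℝ (Fin n) → ℝ} {s K₁ K₂ p q : ℝ} (hs : 0 < s)
    (hv : ContDiff ℝ ∞ v) (hpos : ∀ x, 0 < v x) (hwv : ∀ x, w x = v x ^ (-s))
    (hp : s * (p - 1) = s + 1) (hq : s * (q - 1) = s + 2)
    (heq : ∀ x, 2 * lap w x = K₁ * w x ^ (p - 1) - K₂ * w x ^ (q - 1))
    (x : EuclideanSpace ℝ (Fin n)) :
    v x * lap v x
      = (s + 1) * ∑ i, pd i v x * pd i v x + K₂ / (2 * s) - K₁ / (2 * s) * v x := by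
  have dv : Differentiable ℝ v := hv.differentiable (by simp)
  have e1 : ∀ i, pd i w = fun y => -s * (v y ^ (-s - 1) * pd i v y) := by
    intro i
    ext y
    rw [show w = fun y => v y ^ (-s) from funext hwv, pd_rpow dv hpos]
    ring
  have e2 : ∀ i, pd i (pd i w) x
      = -s * (v x ^ (-s - 1) * pd i (pd i v) x
        + (-s - 1) * v x ^ (-s - 2) * (pd i v x * pd i v x)) := by
    intro i
    have d1 : Differentiable ℝ fun y => v y ^ (-s - 1) :=
      (contDiff_rpow hv hpos _).differentiable (by simp)
    have d2 : Differentiable ℝ (pd i v) := (contDiff_pd hv i).differentiable (by simp)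
    rw [e1, pd_const_mul (f := fun y => v y ^ (-s - 1) * pd i v y) (d1.mul d2),
      pd_mul d1 d2, pd_rpow dv hpos,
      show -s - 1 - 1 = -s - 2 by ring]
    ring
  have e3 : lap w x = -s * (v x ^ (-s - 1) * lap v x
      + (-s - 1) * v x ^ (-s - 2) * ∑ i, pd i v x * pd i v x) := by
    unfold lap
    simp_rw [e2]
    rw [← Finset.mul_sum, Finset.sum_add_distrib, ← Finset.mul_sum, ← Finset.mul_sum]
  have h := heq x
  rw [e3, hwv, ← Real.rpow_mul (hpos x).le, ← Real.rpow_mul (hpos x).le,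
    show -s * (p - 1) = -s - 2 + 1 by linarith, show -s - 1 = -s - 2 + 1 by ring,
    show -s * (q - 1) = -s - 2 by linarith, Real.rpow_add_one (hpos x).ne'] at h
  have hr := Real.rpow_pos_of_pos (hpos x) (-s - 2)
  -- Every term is `v ^ (-s - 2)` times an expression free of real powers, so that factor can be
  -- cancelled.
  have h' : v x ^ (-s - 2) * (-(2 * s) * (v x * lap v x - (s + 1) * ∑ i, pd i v x * pd i v x)
      - K₁ * v x + K₂) = 0 := by
    linear_combination h
  have h'' := (mul_eq_zero.mp h').resolve_left hr.ne'
  generalize ∑ i, pd i v x * pd i v x = S at h'' ⊢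
  field_simp
  linear_combination -h''

lemma pd_coord (i j : Fin n) (x : EuclideanSpace ℝ (Fin n)) :
    pd j (fun y : EuclideanSpace ℝ (Fin n) => y i) x = if j = i then 1 else 0 := by
  have : (fun y : EuclideanSpace ℝ (Fin n) => y i) = (EuclideanSpace.proj i : _ →L[ℝ] ℝ) := rfl
  rw [pd, this, ContinuousLinearMap.fderiv]
  simp [eq_comm]

/-- A function whose Hessian is a constant multiple of the metric is a quadratic polynomial. -/
lemma eq_quadratic_of_pd_pd_eq {v : EuclideanSpace ℝ (Fin n) → ℝ} {b : ℝ}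
    (hv : ContDiff ℝ ∞ v)
    (h : ∀ i j x, pd j (pd i v) x = if j = i then 2 * b else 0) (x : EuclideanSpace ℝ (Fin n)) :
    v x = v 0 + ∑ i, pd i v 0 * x i + b * ‖x‖ ^ 2 := by
  have dv : Differentiable ℝ v := hv.differentiable (by simp)
  have dc : ∀ i, Differentiable ℝ fun y : EuclideanSpace ℝ (Fin n) => y i := fun i => by fun_prop
  have h1 : ∀ i y, pd i v y = pd i v 0 + 2 * b * y i := by
    intro i y
    have dp : Differentiable ℝ (pd i v) := (contDiff_pd hv i).differentiable (by simp)
    have := eq_of_pd_eq_zero (f := fun z => pd i v z - 2 * b * z i) (by fun_prop)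
      (fun j z => by
        rw [pd_sub dp (by fun_prop), pd_const_mul (dc i), h, pd_coord]
        split_ifs <;> ring) y 0
    simp only [PiLp.zero_apply, mul_zero, sub_zero] at this
    linarith
  have key : ∀ y j, pd j (fun z : EuclideanSpace ℝ (Fin n) =>
      v z - ∑ i, (pd i v 0 * z i + b * (z i * z i))) y = 0 := by
    intro y j
    have dt : ∀ i, Differentiable ℝ fun z : EuclideanSpace ℝ (Fin n) =>
        pd i v 0 * z i + b * (z i * z i) := fun i => by fun_prop
    rw [pd_sub dv (by fun_prop),
      pd_sum (F := fun i (z : EuclideanSpace ℝ (Fin n)) => pd i v 0 * z i + b * (z i * z i)) dt]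
    have : ∀ i, pd j (fun z : EuclideanSpace ℝ (Fin n) => pd i v 0 * z i + b * (z i * z i)) y
        = if j = i then pd i v 0 + 2 * b * y i else 0 := by
      intro i
      rw [pd_add (by fun_prop) (by fun_prop), pd_const_mul (dc i), pd_const_mul (by fun_prop),
        pd_mul (dc i) (dc i), pd_coord]
      split_ifs <;> ring
    simp_rw [this]
    simp [h1 j y]
  have dd : Differentiable ℝ fun z : EuclideanSpace ℝ (Fin n) =>
      v z - ∑ i, (pd i v 0 * z i + b * (z i * z i)) := by fun_prop
  have h2 := eq_of_pd_eq_zero dd (fun j y => key y j) x 0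
  rw [EuclideanSpace.norm_sq_eq]
  simp only [PiLp.zero_apply, mul_zero, add_zero, Finset.sum_const_zero, sub_zero,
    Finset.sum_add_distrib, ← Finset.mul_sum] at h2
  simp only [Real.norm_eq_abs, sq_abs]
  simp only [← sq] at h2
  linarith

/-- A positive function with constant multiple of the identity as Hessian and at least quadratic
growth is a positive definite quadratic polynomial. -/
lemma exists_quadratic_of_pd_pd_eq (hn : 1 ≤ n) {v : EuclideanSpace ℝ (Fin n) → ℝ} {b c : ℝ}
    (hv : ContDiff ℝ ∞ v) (hpos : ∀ x, 0 < v x) (hc : 0 < c)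
    (hgrowth : ∀ x, c * (1 + ‖x‖ ^ 2) ≤ v x)
    (h : ∀ i j x, pd j (pd i v) x = if j = i then 2 * b else 0) :
    ∃ a, 0 < a ∧ 0 < b ∧ ∃ x₀ : EuclideanSpace ℝ (Fin n), ∀ x, v x = a + b * ‖x - x₀‖ ^ 2 := by
  have hq := eq_quadratic_of_pd_pd_eq hv h
  -- Adding the growth bounds at `y` and `-y` removes the linear part. If `b ≤ 0`, then `c (1 + t²)
  -- ≤ v 0` for all `t`, which fails at `t = v 0 / c + 1`.
  have hb : 0 < b := by
    have hlarge : ∀ t : ℝ, c * (1 + t ^ 2) ≤ v 0 + b * t ^ 2 := by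
      intro t
      let y : EuclideanSpace ℝ (Fin n) := EuclideanSpace.single ⟨0, hn⟩ t
      have hy : ‖y‖ ^ 2 = t ^ 2 := by simp [y]
      have h1 := hgrowth y
      have h2 := hgrowth (-y)
      rw [hq, norm_neg, hy] at h2
      rw [hq, hy] at h1
      simp only [PiLp.neg_apply, mul_neg, Finset.sum_neg_distrib] at h2
      linarith
    by_contra hb
    push Not at hb
    have h1 := hlarge (v 0 / c + 1)
    have h2 : 0 < v 0 / c := div_pos (hpos 0) hc
    have h3 : v 0 = c * (v 0 / c) := by field_simp
    have h4 : b * (v 0 / c + 1) ^ 2 ≤ 0 := mul_nonpos_of_nonpos_of_nonneg hb (sq_nonneg _)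
    nlinarith [mul_pos hc h2, mul_pos hc (mul_pos h2 h2)]
  -- The critical point of the quadratic; the constant term is then `v x₀`, hence positive.
  let x₀ : EuclideanSpace ℝ (Fin n) := WithLp.toLp 2 fun i => -(pd i v 0) / (2 * b)
  have hsq : ∀ x, v x = (v 0 - b * ‖x₀‖ ^ 2) + b * ‖x - x₀‖ ^ 2 := by
    intro x
    rw [hq x, @norm_sub_sq_real, PiLp.inner_apply]
    have : ∑ i, inner ℝ (x i) (x₀ i) = -(2 * b)⁻¹ * ∑ i, pd i v 0 * x i := by
      rw [Finset.mul_sum]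
      refine Finset.sum_congr rfl fun i _ => ?_
      simp only [x₀, RCLike.inner_apply, conj_trivial]
      field_simp
    rw [this]
    field_simp
    ring
  refine ⟨v 0 - b * ‖x₀‖ ^ 2, ?_, hb, x₀, hsq⟩
  have := hsq x₀
  rw [sub_self, norm_zero] at this
  have := hpos x₀
  linarith

end Classification

/-! ### Integrability of negative powers of `v`. -/

section Decay

variable {n : ℕ} {v : EuclideanSpace ℝ (Fin n) → ℝ} {N c C : ℝ}

lemma integrable_rpow_of_quadratic_growth (hv : Continuous v) (hpos : ∀ x, 0 < v x)
    (hc : 0 < c) (hgrowth : ∀ x, c * (1 + ‖x‖ ^ 2) ≤ v x) (hN : (n : ℝ) < 2 * (N - 1)) :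
    Integrable fun x => v x ^ (1 - N) := by
  have hN1 : 1 - N ≤ 0 := by
    have : (0 : ℝ) ≤ n := n.cast_nonneg
    linarith
  have h := integrable_rpow_neg_one_add_norm_sq (E := EuclideanSpace ℝ (Fin n)) (μ := volume)
    (r := 2 * (N - 1)) (by simpa using hN)
  refine (h.const_mul (c ^ (1 - N))).mono'
    (hv.rpow_const fun x => Or.inl (hpos x).ne').aestronglyMeasurable (ae_of_all _ fun x => ?_)
  rw [Real.norm_of_nonneg (Real.rpow_pos_of_pos (hpos x) _).le,
    show -(2 * (N - 1)) / 2 = 1 - N by ring, ← Real.mul_rpow hc.le (by positivity)]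
  exact Real.rpow_le_rpow_of_nonpos (by positivity) (hgrowth x) hN1

/-- Serves for `f = |∇v|²`, the Dirichlet energy of `w` up to a constant, and for `f = 1`. -/
lemma integrable_rpow_mul_of_le (hv : Continuous v) (hpos : ∀ x, 0 < v x)
    (hint : Integrable fun x => v x ^ (1 - N)) {f : EuclideanSpace ℝ (Fin n) → ℝ}
    (hf : Continuous f) {K : ℝ} (hK : ∀ x, |f x| ≤ K * v x) :
    Integrable fun x => v x ^ (-N) * f x := by
  refine (hint.const_mul K).mono'
    ((hv.rpow_const fun x => Or.inl (hpos x).ne').mul hf).aestronglyMeasurable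
    (ae_of_all _ fun x => ?_)
  have hr := Real.rpow_pos_of_pos (hpos x) (-N)
  rw [norm_mul, Real.norm_of_nonneg hr.le, Real.norm_eq_abs, show 1 - N = -N + 1 by ring,
    Real.rpow_add_one (hpos x).ne']
  calc _ ≤ v x ^ (-N) * (K * v x) := mul_le_mul_of_nonneg_left (hK x) hr.le
    _ = _ := by ring

end Decay

end WeightedYamabe

/-! ### Assembly of the proof, with the constants of the equation. -/

open WeightedYamabe

theorem proposition9p6 (n : ℕ) (hn : 1 ≤ n) (m : ℝ) (hm : 0 ≤ m) (hmn : 2 < m + n)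
    (w : EuclideanSpace ℝ (Fin n) → ℝ) (hw : ContDiff ℝ ∞ w) (hwpos : ∀ x, 0 < w x)
    -- the measure `1^m dvol` is `e^{-φ} dvol` with `φ = 0`
    (hcrit : WeightedYamabe.IsCriticalPoint
      (WeightedYamabe.yamabeQuotient (fun _ : EuclideanSpace ℝ (Fin n) => (0 : ℝ)) m) w)
    (hkelvin : ∃ W : EuclideanSpace ℝ (Fin n) → ℝ, ContDiff ℝ 2 W ∧ (∀ x, 0 < W x) ∧
      ∀ x, x ≠ 0 → W x = WeightedYamabe.kelvinTransform m w x) :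
    ∃ a b : ℝ, 0 < a ∧ 0 < b ∧ ∃ x₀ : EuclideanSpace ℝ (Fin n),
      ∀ x, w x = (a + b * ‖x - x₀‖ ^ 2) ^ (-((m + n - 2) / 2)) := by
  obtain ⟨W, hW, hWpos, hWw⟩ := hkelvin
  have hn0 : (0 : ℝ) < n := by positivity
  set s : ℝ := (m + n - 2) / 2 with hs_def
  have hs : 0 < s := by simp only [hs_def]; linarith
  obtain ⟨N, hN⟩ : ∃ N : ℝ, N = m + n := ⟨_, rfl⟩
  have hNs : N = 2 * s + 2 := by rw [hN, hs_def]; ring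
  let v : EuclideanSpace ℝ (Fin n) → ℝ := fun x => w x ^ (-s⁻¹)
  have hv : ContDiff ℝ ∞ v := contDiff_rpow hw hwpos _
  have hpos : ∀ x, 0 < v x := fun x => Real.rpow_pos_of_pos (hwpos x) _
  have hwv : ∀ x, w x = v x ^ (-s) := by
    intro x
    simp only [v]
    rw [← Real.rpow_mul (hwpos x).le, neg_mul_neg, inv_mul_cancel₀ hs.ne', Real.rpow_one]
  -- Only first derivatives of the extended transform enter; the bound on `Δv` will come from the
  -- equation.
  obtain ⟨c, C, hc, hgrowth, hC, hC'⟩ := quadratic_growth_of_inversion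
    (V := fun x => W x ^ (-s⁻¹)) (hv.of_le (by simp)) hpos
    ((hW.of_le (by norm_num)).rpow_const_of_ne fun x => (hWpos x).ne')
    (fun x => Real.rpow_pos_of_pos (hWpos x) _)
    (rpow_eq_norm_sq_mul_of_kelvinTransform hs (by rw [hs_def]; ring) hwpos hWw)
  have hint : Integrable fun x => v x ^ (1 - N) :=
    integrable_rpow_of_quadratic_growth hv.continuous hpos hc hgrowth (by rw [hN]; linarith)
  have hC0 : 0 ≤ C := by
    have := (hpos 0).le.trans (hC 0)
    simpa using this
  have hcv : ∀ x, c ≤ v x := fun x => le_trans (by nlinarith [sq_nonneg ‖x‖]) (hgrowth x)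
  let S : EuclideanSpace ℝ (Fin n) → ℝ := fun x => ∑ i, pd i v x * pd i v x
  have hScont : Continuous S := by
    have := fun i => (contDiff_pd hv i).continuous
    fun_prop
  have hS : ∀ x, |S x| ≤ n * C / c * v x := by
    intro x
    have h1 : 0 ≤ S x := Finset.sum_nonneg fun i _ => mul_self_nonneg _
    rw [abs_of_nonneg h1]
    calc S x ≤ ∑ _i : Fin n, C * (1 + ‖x‖ ^ 2) :=
          Finset.sum_le_sum fun i _ => by rw [← sq]; exact hC' i x
      _ = n * C / c * (c * (1 + ‖x‖ ^ 2)) := by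
          simp only [Finset.sum_const, Finset.card_univ, Fintype.card_fin, nsmul_eq_mul]
          field_simp
      _ ≤ _ := mul_le_mul_of_nonneg_left (hgrowth x) (by positivity)
  have hintS : Integrable fun x => v x ^ (-N) * S x :=
    integrable_rpow_mul_of_le hv.continuous hpos hint hScont hS
  have hintN : Integrable fun x => v x ^ (-N) := by
    have := integrable_rpow_mul_of_le (f := fun _ => 1) (K := 1 / c) hv.continuous hpos hint
      continuous_const fun x => by
        rw [abs_one, div_mul_eq_mul_div, one_mul, le_div_iff₀ hc, one_mul]
        exact hcv x
    simpa using this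
  set p : ℝ := 2 * (m + n - 1) / (m + n - 2) with hp
  set q : ℝ := 2 * (m + n) / (m + n - 2) with hq
  have hmn' : m + n - 2 ≠ 0 := by linarith
  -- These exponents turn the two power integrals of `w` into integrals of `v ^ (1 - N)` and `v ^
  -- (-N)`.
  have hsp : s * p = N - 1 := by rw [hp, hs_def, hN]; field_simp
  have hsq : s * q = N := by rw [hq, hs_def, hN]; field_simp
  have hwp : ∀ x, w x ^ p = v x ^ (1 - N) := fun x => by
    rw [hwv, ← Real.rpow_mul (hpos x).le]; congr 1; linarith
  have hwq : ∀ x, w x ^ q = v x ^ (-N) := fun x => by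
    rw [hwv, ← Real.rpow_mul (hpos x).le]; congr 1; linarith
  have hwS : ∀ x, ∑ i, pd i w x ^ 2 = s ^ 2 * (v x ^ (-N) * S x) := by
    intro x
    have e : ∀ i, pd i w x = -s * v x ^ (-s - 1) * pd i v x := fun i => by
      rw [show w = fun y => v y ^ (-s) from funext hwv,
        pd_rpow (hv.differentiable (by simp)) hpos]
    have e2 : v x ^ (-N) = v x ^ (-s - 1) * v x ^ (-s - 1) := by
      rw [← Real.rpow_add (hpos x)]; congr 1; linarith
    rw [e2]
    simp_rw [e, S, Finset.mul_sum]
    exact Finset.sum_congr rfl fun i _ => by ring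
  have hp1 : 1 ≤ p := by nlinarith
  have hq1 : 1 ≤ q := by nlinarith
  have hEL := eulerLagrange hp hq hp1 hq1 hw hwpos hcrit
    (by simp_rw [hwS]; exact hintS.const_mul _) (by simp_rw [hwp]; exact hint)
    (by simp_rw [hwq]; exact hintN)
  simp_rw [hwS] at hEL
  have eB : ∫ x, w x ^ p = ∫ x, v x ^ (1 - N) := by simp_rw [hwp]
  have eC : ∫ x, w x ^ q = ∫ x, v x ^ (-N) := by simp_rw [hwq]
  rw [eB, eC, integral_const_mul] at hEL
  have pB := integral_rpow_pos hpos hint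
  have pC := integral_rpow_pos hpos hintN
  set A' := ∫ x, v x ^ (-N) * S x with hA'
  set B := ∫ x, v x ^ (1 - N) with hB
  set D := ∫ x, v x ^ (-N) with hD
  have hv_eq := equation_of_rpow hs hv hpos hwv (by linarith) (by linarith) hEL
  set c₂ := s ^ 2 * A' * ((2 * m + n - 2) / n) * q / D / (2 * s) with hc₂
  -- Chosen so that the coefficient of `v` in the equation is `2 m b`. For `m = 0` the equation does
  -- not involve `b`, and this formula is what determines it.
  set b := (N - 1) * A' / (2 * n * B) with hb
  have hc₂' : c₂ * D = N / 2 * A' * ((2 * m + n - 2) / n) := by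
    rw [hc₂, ← hsq]
    field_simp
  have hbB : 2 * n * b * B = (N - 1) * A' := by
    rw [hb]
    field_simp
  have hK₁ : s ^ 2 * A' * (2 * m / n) * p / B / (2 * s) = 2 * m * b := by
    rw [hb, ← hsp]
    field_simp
  rw [hK₁] at hv_eq
  have heq : ∀ x, v x * lap v x
      = N / 2 * ∑ i, pd i v x * pd i v x + c₂ - 2 * m * b * v x := by
    intro x
    rw [hv_eq x, hNs]
    ring
  -- Divide the equation by `v`, using `v ≥ c` and `|∇v|² ≤ (n C / c) v`.
  have hF : ∀ x, |lap v x| ≤ N / 2 * (n * C / c) + |c₂| / c + |2 * m * b| := by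
    intro x
    have e : lap v x = N / 2 * S x / v x + c₂ / v x - 2 * m * b := by
      have h1 := heq x
      have h2 := (hpos x).ne'
      change _ = N / 2 * S x + _ - _ at h1
      field_simp
      linear_combination 2 * h1
    rw [e]
    refine (abs_sub _ _).trans (add_le_add ((abs_add_le _ _).trans (add_le_add ?_ ?_)) le_rfl)
    · rw [abs_div, abs_mul, abs_of_pos (hpos x), abs_of_pos (show 0 < N / 2 by linarith),
        div_le_iff₀ (hpos x), mul_assoc]
      exact mul_le_mul_of_nonneg_left (hS x) (by linarith)
    · rw [abs_div, abs_of_pos (hpos x)]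
      exact div_le_div_of_nonneg_left (abs_nonneg _) hc (hcv x)
  -- By the equation the integral is `(N/2) A' + c₂ D - 2 N b B`. Since `1 + (2m + n - 2)/n = 2 (N -
  -- 1)/n`, the first two terms add up to `N (N - 1) A' / n = 2 N b B`.
  have hzero : ∫ x, v x ^ (1 - N) * (lap v x - 2 * n * b) = 0 := by
    have e : ∀ x, v x ^ (1 - N) * (lap v x - 2 * n * b)
        = N / 2 * (v x ^ (-N) * S x) + c₂ * v x ^ (-N) - 2 * N * b * v x ^ (1 - N) := by
      intro x
      rw [show 1 - N = -N + 1 by ring, Real.rpow_add_one (hpos x).ne']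
      have h1 := heq x
      change _ = N / 2 * S x + _ - _ at h1
      linear_combination v x ^ (-N) * h1 + 2 * b * v x ^ (-N) * v x * hN
    have i1 : Integrable fun x => N / 2 * (v x ^ (-N) * S x) + c₂ * v x ^ (-N) :=
      (hintS.const_mul _).add (hintN.const_mul _)
    simp_rw [e]
    rw [integral_sub i1 (hint.const_mul _),
      integral_add (hintS.const_mul _) (hintN.const_mul _), integral_const_mul,
      integral_const_mul, integral_const_mul, ← hA', ← hB, ← hD, hc₂']
    have : b * B = (N - 1) * A' / (2 * n) := by
      field_simp
      linear_combination hbB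
    rw [mul_assoc (2 * N) b B, this, hN]
    field_simp
    ring
  have hhess := pd_pd_eq_of_equation hn hm hN hv hpos heq hint hC hC' hF hzero
  obtain ⟨a, ha, hb0, x₀, hvq⟩ := exists_quadratic_of_pd_pd_eq hn hv hpos hc hgrowth hhess
  exact ⟨a, b, ha, hb0, x₀, fun x => by rw [hwv, hvq]⟩
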